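/- **Definitions.** Let $\Omega=\mathbb{R}/2\pi\mathbb{Z}=(-\pi,\pi]$ carry the normalized Lebesgue measure, and for a random variable $X$ on $\Omega$ put $\delta(X)=\sqrt{\mathbb{E}(X^2)-\mathbb{E}(X)^2}\,/\,\mathbb{E}(X)$. Arguments of complex numbers are taken in $(-\pi,\pi]$. For $n\ge 2$ let $\Theta_n$ be the set of convex $n$-gons $T=T(\alpha_1,\dots,\alpha_n)$, that is, of sequences of $n$ distinct complex numbers such that, with indices mod $n$, the arguments of the edge vectors $\alpha_{j+1}-\alpha_j$ have lifts $\theta_1\le\theta_2\le\dots\le\theta_n\le\theta_1+2\pi$ from $\mathbb{R}/2\pi\mathbb{Z}$ to $\mathbb{R}$ (straight angles are allowed). Let $$X_T(\omega)=\sum_{j=1}^n|\alpha_{j+1}-\alpha_j|\,\max\{\sin(\arg(\alpha_{j+1}-\alpha_j)-\omega),0\},$$ which is the length of the orthogonal projection (shadow) of $T$ in the direction $\omega$. Let $\mathcal{H}=\{z\in\mathbb{C}:\ \Im z>0,\text{ or }\Im z=0\text{ and }\Re z\ge 0\}$, and let $\iota(z)=z$ if $z\in\mathcal{H}$ and $\iota(z)=-z$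 otherwise. A pre-edge bundle of size $m$ is a sequence $\mathcal{B}=(\beta_1,\dots,\beta_m)$ of nonzero elements of $\mathcal{H}$ with $0\le\arg\beta_1<\dots<\arg\beta_m<\pi$; put $\tilde X_{\mathcal{B}}(\omega)=\sum_{j=1}^m\frac{|\beta_j|}{2}|\sin(\arg\beta_j-\omega)|$. It is called regular, and denoted $R_m$, if $|\beta_1|=\dots=|\beta_m|$ and $\arg\beta_{j+1}-\arg\beta_j\equiv\pi/m \pmod{\pi}$ for $j=1,\dots,m$ (indices mod $m$). The asymmetrization of $T\in\Theta_n$ is the pre-edge bundle consisting of the vectors obtained from the family $\iota(\alpha_{j+1}-\alpha_j)$, $j=1,\dots,n$, by adding up all members with the same argument. Finally let $$P(n)=\Big\{(c_0,\dots,c_{n-1})\in\{-1,1\}^n:\ \sum_{j=0}^{n-1}c_j e^{j\pi\mathbf{i}/n}=0\Big\},\qquad \nu_n=\sqrt{\frac{\pi}{4n\tan(\frac{\pi}{2n})}+\frac{\pi^2}{8n^2\sin^2(\frac{\pi}{2n})}-1}.$$ **Theorem.** Let $n\ge 2$ be an integer which is not a power of $2$. Then $$\min_{T\in\Theta_n}\delta(X_T)=\delta(\tilde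 X_{R_n})=\nu_n,$$ where the minimum is attained and the second equality holds for every regular pre-edge bundle $R_n$ of size $n$. For $T\in\Theta_n$ the following are equivalent: 1. $\delta(X_T)=\nu_n$; 2. the asymmetrization of $T$ is a regular pre-edge bundle of size $n$; 3. $T$ is similar to a polygon $T(\alpha_1,\dots,\alpha_n)\in\Theta_n$ such that, for some $(c_0,\dots,c_{n-1})\in P(n)$, $$\{\alpha_{j+1}-\alpha_j:\ j=1,\dots,n\}=\{c_j e^{j\pi\mathbf{i}/n}:\ j=0,\dots,n-1\}.$$ -/

import Mathlib

open MeasureTheory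
open scoped Real

noncomputable section

namespace PolygonWidth

/-! ### Random directions and the deviation rate -/

/-- The probability space of directions `ω ∈ ℝ / 2πℤ = (-π, π]` with the normalized Lebesgue
measure, realized on `ℝ`. -/
def directionMeasure : Measure ℝ :=
  ProbabilityTheory.cond volume (Set.Ioc (-π) π)

/-- Expectation of a random variable on the space of directions. -/
def expectation (X : ℝ → ℝ) : ℝ :=
  ∫ ω, X ω ∂directionMeasure

/-- Deviation rate `δ(X) = √(E(X²) - E(X)²) / E(X)`. -/
def deviationRate (X : ℝ → ℝ) : ℝ :=
  √(expectation (fun ω => X ω ^ 2) - expectation X ^ 2) / expectation X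

/-- The number `ν_n`. -/
def nu (n : ℕ) : ℝ :=
  √(π / (4 * n * Real.tan (π / (2 * n))) + π ^ 2 / (8 * n ^ 2 * Real.sin (π / (2 * n)) ^ 2) - 1)

/-! ### Convex polygons -/

/-- The edge vectors `α_{j+1} - α_j` of a closed polygon, with cyclic indices. -/
def edge {n : ℕ} (α : Fin n → ℂ) (j : Fin n) : ℂ :=
  α (finRotate n j) - α j

/-- The space `Θ_n` of convex `n`-gons (possibly degenerate, i.e. with straight angles): sequences
of `n` distinct points such that the arguments of the consecutive edges, suitably lifted from
`ℝ / 2πℤ` to `ℝ`, are nondecreasing and stay within one full turn. -/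
def Theta (n : ℕ) : Set (Fin n → ℂ) :=
  {α | Function.Injective α ∧
    ∃ θ : Fin n → ℝ, (∀ j, (θ j : Real.Angle) = ((edge α j).arg : Real.Angle)) ∧
      Monotone θ ∧ ∀ j k, θ k ≤ θ j + 2 * π}

/-- `X_α(ω) = |α| sin(arg α - ω)₊`, the shadow of (the right side of) the vector `α`
in the light from the direction `ω`. -/
def vectorShadow (α : ℂ) (ω : ℝ) : ℝ :=
  ‖α‖ * max (Real.sin (α.arg - ω)) 0

/-- `X_T(ω)`, the sum of the shadows of the edges of `T`. For a convex polygon this is the length of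
the orthogonal projection of `T` in the direction `ω`. -/
def shadow {n : ℕ} (α : Fin n → ℂ) (ω : ℝ) : ℝ :=
  ∑ j, vectorShadow (edge α j) ω

/-! ### Pre-edge bundles and asymmetrization -/

/-- The set `ℋ` of representatives of complex numbers modulo sign. -/
def upperHalf : Set ℂ :=
  {z | 0 < z.im ∨ (z.im = 0 ∧ 0 ≤ z.re)}

open Classical in
/-- The representative `ι(z) ∈ {z, -z}` in `ℋ`. -/
def iota (z : ℂ) : ℂ :=
  if z ∈ upperHalf then z else -z

/-- The set of vectors obtained from a finite family by adding up all members with the same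
argument. -/
def abbreviation {n : ℕ} (a : Fin n → ℂ) : Set ℂ :=
  Set.range fun k => ∑ j with (a j).arg = (a k).arg, a j

/-- Pre-edge bundles of size `m`: sequences of nonzero elements of `ℋ` (so with arguments in
`[0, π)`) with strictly increasing arguments. -/
structure PreEdgeBundle (m : ℕ) where
  preEdge : Fin m → ℂ
  mem_upperHalf : ∀ j, preEdge j ∈ upperHalf
  ne_zero : ∀ j, preEdge j ≠ 0
  strictMono_arg : StrictMono fun j => (preEdge j).arg

/-- The random variable of a pre-edge bundle, `∑_j (|β_j| / 2) |sin(arg β_j - ω)|`. -/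
def PreEdgeBundle.shadow {m : ℕ} (B : PreEdgeBundle m) (ω : ℝ) : ℝ :=
  ∑ j, ‖B.preEdge j‖ / 2 * |Real.sin ((B.preEdge j).arg - ω)|

/-- Regular pre-edge bundles `R_m`: all pre-edges have the same length and cyclically consecutive
arguments differ by `π / m` modulo `π`. -/
def PreEdgeBundle.IsRegular {m : ℕ} (B : PreEdgeBundle m) : Prop :=
  (∀ j k, ‖B.preEdge j‖ = ‖B.preEdge k‖) ∧
    ∀ j, (B.preEdge (finRotate m j)).arg - (B.preEdge j).arg ≡ π / m [PMOD π]

/-- `B` is the asymmetrization of the polygon `α`: its pre-edges are obtained from the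
vectors `ι(α_{j+1} - α_j)` by adding up those with the same argument. (A bundle is determined by the
set of its pre-edges, so `B` is unique.) -/
def IsAsymmetrization {n m : ℕ} (α : Fin n → ℂ) (B : PreEdgeBundle m) : Prop :=
  Set.range B.preEdge = abbreviation fun j => iota (edge α j)

/-- The set `P(n)` of sign vectors `c ∈ {-1, 1}ⁿ` with `∑_j c_j exp(jπi/n) = 0`. -/
def signVectors (n : ℕ) : Set (Fin n → ℤ) :=
  {c | (∀ j, c j = -1 ∨ c j = 1) ∧
    ∑ j : Fin n, (c j : ℂ) * Complex.exp ((j : ℕ) * π * Complex.I / n) = 0}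

end PolygonWidth

end

/-! The edges of a closed polygon sum to zero, so its shadow equals half the sum of the projected
lengths of all edges (`shadow_eq_halfWidth`). Only the edges up to sign and order matter. Sorting
their directions modulo `π` turns the shadow into a `π`-periodic sum `X` of `n` weighted functions
`|sin (ω - u j)|`, where repeated nodes are allowed.

Between neighbouring nodes `X` is a sinusoid. On an arc of length `t` a sinusoid `f` satisfies `(∫
f)² ≤ arcGain t * ∫ f²`, and completing the square over all arcs gives `(∫ X)² ≤ (∑ arcGain (t k)) *
∫ X²`. The arcs add up to `π` and `arcGain` is strictly concave, so Jensen bounds the sum by `n *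
arcGain (π / n)`. This bounds `E(X²) / E(X)²` from below, and `ν_n` is exactly the resulting bound
(`sq_integral_sineSum_le`, `nu_le_deviationRate_sineSum`).

Equality forces equal arcs and the same pure cosine on each, so `X` has one common value at all
nodes. The weights are second differences of `X` at the nodes, hence are equal too: up to sign the
edges form a regular fan. Conversely, a regular fan gives `ν_n` by direct computation
(`deviationRate_equidistant`).

The bound is attained once some choice of signs makes the fan sum to zero. Such signs exist when `n`
has an odd factor greater than 1 (`signVectors_nonempty`), and the signed fan, sorted by argument,
bounds a convex polygon with distinct vertices (`exists_polygon_of_signVector`). -/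

namespace PolygonWidth

/-! ### The gain of an arc -/

/-- The largest value of `(∫ f)² / ∫ f²` for a sinusoid `f` on an interval of length `t`. -/
noncomputable def arcGain (t : ℝ) : ℝ :=
  4 * (1 - Real.cos t) / (t + Real.sin t)

theorem add_sin_pos {t : ℝ} (h0 : 0 < t) (h1 : t ≤ π) : 0 < t + Real.sin t :=
  add_pos_of_pos_of_nonneg h0 (Real.sin_nonneg_of_nonneg_of_le_pi h0.le h1)

theorem arcGain_zero : arcGain 0 = 0 := by simp [arcGain]

theorem arcGain_nonneg {t : ℝ} (h0 : 0 ≤ t) (h1 : t ≤ π) : 0 ≤ arcGain t :=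
  div_nonneg (by linarith [Real.cos_le_one t])
    (add_nonneg h0 (Real.sin_nonneg_of_nonneg_of_le_pi h0 h1))

theorem arcGain_pos {t : ℝ} (h0 : 0 < t) (h1 : t ≤ π) : 0 < arcGain t := by
  refine div_pos ?_ (add_sin_pos h0 h1)
  have := Real.cos_lt_cos_of_nonneg_of_le_pi le_rfl h1 h0
  rw [Real.cos_zero] at this
  linarith

theorem hasDerivAt_arcGain {t : ℝ} (h0 : 0 < t) (h1 : t ≤ π) :
    HasDerivAt arcGain (4 * (t * Real.sin t) / (t + Real.sin t) ^ 2) t := by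
  have h := (((Real.hasDerivAt_cos t).const_sub 1).const_mul 4).div
    ((hasDerivAt_id t).add (Real.hasDerivAt_sin t)) (add_sin_pos h0 h1).ne'
  refine h.congr_deriv ?_
  congr 1
  simp only [id, Pi.add_apply]
  linear_combination 4 * Real.sin_sq_add_cos_sq t

/-- At `0` the quotient is `0 / 0`, whose default value `0` is the true limit, because `0 ≤ arcGain
t ≤ 2 * t`. -/
theorem continuousOn_arcGain : ContinuousOn arcGain (Set.Icc 0 π) := by
  intro t ht
  rcases ht.1.eq_or_lt with rfl | h0
  · rw [ContinuousWithinAt, arcGain_zero]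
    refine squeeze_zero' (g := fun t => 2 * t) ?_ ?_ ?_
    · filter_upwards [self_mem_nhdsWithin] with t ht using arcGain_nonneg ht.1 ht.2
    · filter_upwards [self_mem_nhdsWithin] with t ht
      rcases ht.1.eq_or_lt with rfl | h0
      · simp [arcGain_zero]
      · rw [arcGain, div_le_iff₀ (add_sin_pos h0 ht.2)]
        have h1 := Real.one_sub_sq_div_two_le_cos (x := t)
        have h2 := mul_nonneg h0.le (Real.sin_nonneg_of_nonneg_of_le_pi h0.le ht.2)
        nlinarith
    · have : Filter.Tendsto (fun t : ℝ => 2 * t) (nhds 0) (nhds (2 * 0)) :=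
        (continuous_const.mul continuous_id).tendsto 0
      rw [mul_zero] at this
      exact this.mono_left nhdsWithin_le_nhds
  · exact (hasDerivAt_arcGain h0 ht.2).continuousAt.continuousWithinAt

/-- Strict concavity of `sin` and `sin 0 = 0` make `sin t / t` strictly decreasing. -/
theorem mul_sin_lt_mul_sin {x y : ℝ} (hx : 0 < x) (hxy : x < y) (hy : y ≤ π) :
    x * Real.sin y < y * Real.sin x := by
  have h := strictConcaveOn_sin_Icc.2 (⟨le_rfl, Real.pi_pos.le⟩ : (0 : ℝ) ∈ Set.Icc 0 π)
    (⟨(hx.trans hxy).le, hy⟩ : y ∈ Set.Icc 0 π) (hx.trans hxy).ne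
    (sub_pos.2 ((div_lt_one (hx.trans hxy)).2 hxy)) (div_pos hx (hx.trans hxy))
    (sub_add_cancel _ _)
  have hy0 := hx.trans hxy
  simp only [smul_eq_mul, mul_zero, Real.sin_zero, zero_add, div_mul_cancel₀ _ hy0.ne'] at h
  rw [div_mul_eq_mul_div, div_lt_iff₀ hy0] at h
  linarith

theorem strictConcaveOn_arcGain : StrictConcaveOn ℝ (Set.Icc 0 π) arcGain := by
  refine StrictAntiOn.strictConcaveOn_of_deriv (convex_Icc 0 π) continuousOn_arcGain ?_
  rw [interior_Icc]
  intro x hx y hy hxy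
  rw [(hasDerivAt_arcGain hx.1 hx.2.le).deriv, (hasDerivAt_arcGain hy.1 hy.2.le).deriv,
    div_lt_div_iff₀ (pow_pos (add_sin_pos hy.1 hy.2.le) 2) (pow_pos (add_sin_pos hx.1 hx.2.le) 2)]
  have h := mul_sin_lt_mul_sin hx.1 hxy hy.2.le
  have h3 := Real.sin_pos_of_mem_Ioo hx
  have h4 := Real.sin_pos_of_mem_Ioo hy
  have h5 : Real.sin x * Real.sin y < x * y :=
    mul_lt_mul'' (Real.sin_lt hx.1) (Real.sin_lt hy.1) h3.le h4.le
  -- The difference of the two sides is `4 * (y sin x - x sin y) * (x y - sin x sin y)`.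
  nlinarith [mul_pos (sub_pos.2 h) (sub_pos.2 h5)]

theorem sum_arcGain_le {n : ℕ} (hn : 0 < n) (t : Fin n → ℝ) (h0 : ∀ k, 0 ≤ t k)
    (hs : ∑ k, t k = π) :
    ∑ k, arcGain (t k) ≤ n * arcGain (π / n) ∧
      (∑ k, arcGain (t k) = n * arcGain (π / n) → ∀ k, t k = π / n) := by
  have hn' : (0 : ℝ) < n := Nat.cast_pos.2 hn
  have hmem : ∀ k ∈ Finset.univ, t k ∈ Set.Icc (0 : ℝ) π := fun k _ =>
    ⟨h0 k, hs ▸ Finset.single_le_sum (fun j _ => h0 j) (Finset.mem_univ k)⟩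
  have hw : ∑ _k : Fin n, (n : ℝ)⁻¹ = 1 := by simp [hn'.ne']
  have hc : ∑ k, (n : ℝ)⁻¹ • t k = π / n := by
    rw [← Finset.smul_sum, hs, smul_eq_mul, inv_mul_eq_div]
  have hv : ∑ k, (n : ℝ)⁻¹ • arcGain (t k) = (n : ℝ)⁻¹ * ∑ k, arcGain (t k) := by
    rw [← Finset.smul_sum, smul_eq_mul]
  constructor
  · have h := strictConcaveOn_arcGain.concaveOn.le_map_sum (t := Finset.univ)
      (fun _ _ => (inv_pos.2 hn').le) hw hmem
    rw [hc, hv, inv_mul_le_iff₀ hn'] at h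
    exact h
  · intro he k
    have h := (strictConcaveOn_arcGain.map_sum_eq_iff (t := Finset.univ)
      (fun _ _ => inv_pos.2 hn') hw hmem).1
      (by rw [hc, hv, he, inv_mul_cancel_left₀ hn'.ne']) k (Finset.mem_univ k)
    rw [h, hc]

/-! ### Sinusoids on an interval -/

/-- Centring at the midpoint makes the sine part odd: it drops out of the integral and is orthogonal
to the cosine part in the energy. -/
theorem integral_sinusoid (a b p q : ℝ) :
    ∫ x in p..q, (a * Real.cos (x - (p + q) / 2) + b * Real.sin (x - (p + q) / 2)) =
      2 * a * Real.sin ((q - p) / 2) := by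
  rw [intervalIntegral.integral_eq_sub_of_hasDerivAt
    (f := fun x => a * Real.sin (x - (p + q) / 2) - b * Real.cos (x - (p + q) / 2))]
  · have h1 : q - (p + q) / 2 = (q - p) / 2 := by ring
    have h2 : p - (p + q) / 2 = -((q - p) / 2) := by ring
    rw [h1, h2, Real.sin_neg, Real.cos_neg]
    ring
  · intro x _
    have hx := (hasDerivAt_id x).sub_const ((p + q) / 2)
    have h := (hx.sin.const_mul a).sub (hx.cos.const_mul b)
    refine h.congr_deriv ?_
    simp only [id]
    ring
  · exact Continuous.intervalIntegrable (by fun_prop) _ _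

theorem integral_sinusoid_sq (a b p q : ℝ) :
    ∫ x in p..q, (a * Real.cos (x - (p + q) / 2) + b * Real.sin (x - (p + q) / 2)) ^ 2 =
      a ^ 2 * ((q - p + Real.sin (q - p)) / 2) + b ^ 2 * ((q - p - Real.sin (q - p)) / 2) := by
  rw [intervalIntegral.integral_eq_sub_of_hasDerivAt
    (f := fun x => (a ^ 2 + b ^ 2) / 2 * (x - (p + q) / 2) + (a ^ 2 - b ^ 2) / 2 *
      (Real.sin (x - (p + q) / 2) * Real.cos (x - (p + q) / 2)) +
      a * b * (Real.sin (x - (p + q) / 2)) ^ 2)]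
  · have h1 : q - (p + q) / 2 = (q - p) / 2 := by ring
    have h2 : p - (p + q) / 2 = -((q - p) / 2) := by ring
    have h3 : Real.sin (q - p) = 2 * Real.sin ((q - p) / 2) * Real.cos ((q - p) / 2) := by
      rw [← Real.sin_two_mul]; congr 1; ring
    rw [h1, h2, Real.sin_neg, Real.cos_neg, h3]
    ring
  · intro x _
    have hx := (hasDerivAt_id x).sub_const ((p + q) / 2)
    have h := ((hx.const_mul ((a ^ 2 + b ^ 2) / 2)).add
      ((hx.sin.mul hx.cos).const_mul ((a ^ 2 - b ^ 2) / 2))).add ((hx.sin.pow 2).const_mul (a * b))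
    refine h.congr_deriv ?_
    simp only [id]
    push_cast
    linear_combination (-(a ^ 2 + b ^ 2) / 2) * Real.sin_sq_add_cos_sq (x - (p + q) / 2)
  · exact Continuous.intervalIntegrable (by fun_prop) _ _

/-- Completing the square for the energy of a sinusoid on an interval. -/
theorem sinusoid_completeSquare (a b c : ℝ) {p q : ℝ} (hpq : p ≤ q) (hπ : q - p ≤ π) :
    (∫ x in p..q, (a * Real.cos (x - (p + q) / 2) + b * Real.sin (x - (p + q) / 2)) ^ 2) -
      2 * c * (∫ x in p..q, (a * Real.cos (x - (p + q) / 2) + b * Real.sin (x - (p + q) / 2))) +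
      c ^ 2 * arcGain (q - p) =
    (q - p + Real.sin (q - p)) / 2 *
        (a - c * (4 * Real.sin ((q - p) / 2) / (q - p + Real.sin (q - p)))) ^ 2 +
      b ^ 2 * ((q - p - Real.sin (q - p)) / 2) := by
  rw [integral_sinusoid, integral_sinusoid_sq]
  rcases hpq.eq_or_lt with rfl | h
  · simp [arcGain_zero]
  · have hP := (add_sin_pos (sub_pos.2 h) hπ).ne'
    have hc : Real.cos (q - p) = 1 - 2 * Real.sin ((q - p) / 2) ^ 2 := by
      rw [← Real.cos_two_mul_eq_one_sub]
      congr 1; ring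
    rw [arcGain, hc]
    field_simp
    ring

/-! ### Weighted sums of shifted functions `|sin|` -/

/-- The function `ω ↦ ∑_{j < n} w_j |sin(ω - u_j)|`. -/
noncomputable def sineSum (n : ℕ) (u w : ℕ → ℝ) (ω : ℝ) : ℝ :=
  ∑ j ∈ Finset.range n, w j * |Real.sin (ω - u j)|

theorem continuous_sineSum (n : ℕ) (u w : ℕ → ℝ) : Continuous (sineSum n u w) := by
  unfold sineSum
  fun_prop

theorem periodic_sineSum (n : ℕ) (u w : ℕ → ℝ) : Function.Periodic (sineSum n u w) π := by
  intro ω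
  refine Finset.sum_congr rfl fun j _ => ?_
  rw [add_sub_right_comm, Real.sin_add_pi, abs_neg]

/-- All nodes lie within a half turn, so on this arc `sin (ω - u j)` is nonnegative for `j ≤ k` and
nonpositive for `j > k`. Each absolute value thus opens with a fixed sign. -/
theorem exists_sinusoid {n : ℕ} {u : ℕ → ℝ} (w : ℕ → ℝ) (hu : Monotone u) (hun : u n = u 0 + π)
    {k : ℕ} (hk : k < n) :
    ∃ a b : ℝ, ∀ ω ∈ Set.Icc (u k) (u (k + 1)), sineSum n u w ω =
      a * Real.cos (ω - (u k + u (k + 1)) / 2) + b * Real.sin (ω - (u k + u (k + 1)) / 2) := by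
  set μ := (u k + u (k + 1)) / 2 with hμ
  refine ⟨∑ j ∈ Finset.range n, w j * ((if j ≤ k then 1 else -1) * Real.sin (μ - u j)),
    ∑ j ∈ Finset.range n, w j * ((if j ≤ k then 1 else -1) * Real.cos (μ - u j)), ?_⟩
  intro ω hω
  rw [Finset.sum_mul, Finset.sum_mul, ← Finset.sum_add_distrib]
  refine Finset.sum_congr rfl fun j hj => ?_
  have hj' := Finset.mem_range.1 hj
  have h0 := hu (Nat.zero_le j)
  have h1 := hu hj'.le
  have h2 := hu (Nat.zero_le k)
  have h3 := hu (Nat.succ_le_of_lt hk)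
  have hs : Real.sin (ω - u j) = Real.cos (ω - μ) * Real.sin (μ - u j) +
      Real.sin (ω - μ) * Real.cos (μ - u j) := by
    rw [add_comm, ← Real.sin_add]
    congr 1
    ring
  have ha : |Real.sin (ω - u j)| = (if j ≤ k then 1 else -1) * Real.sin (ω - u j) := by
    split_ifs with h
    · rw [one_mul, abs_of_nonneg]
      have := hu h
      exact Real.sin_nonneg_of_nonneg_of_le_pi (by linarith [hω.1]) (by linarith [hω.2])
    · rw [abs_of_nonpos, neg_one_mul]
      have := hu (Nat.succ_le_of_lt (not_le.1 h))
      exact Real.sin_nonpos_of_nonpos_of_neg_pi_le (by linarith [hω.2]) (by linarith [hω.1])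
  rw [ha, hs]
  ring

theorem sum_arcs {n : ℕ} {u : ℕ → ℝ} (hun : u n = u 0 + π) :
    ∑ k : Fin n, (u (k + 1) - u k) = π := by
  rw [Fin.sum_univ_eq_sum_range (fun k => u (k + 1) - u k) n, Finset.sum_range_sub, hun]
  ring

theorem arc_le_pi {n : ℕ} {u : ℕ → ℝ} (hu : Monotone u) (hun : u n = u 0 + π) {k : ℕ}
    (hk : k < n) : u (k + 1) - u k ≤ π := by
  have h2 := hu (Nat.zero_le k)
  have h3 := hu (Nat.succ_le_of_lt hk)
  linarith

theorem sin_le_of_nonneg {t : ℝ} (h : 0 ≤ t) : 0 ≤ t - Real.sin t :=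
  sub_nonneg.2 (Real.sin_le h)

theorem sum_integral_arcs {n : ℕ} {u : ℕ → ℝ} (hun : u n = u 0 + π) {f : ℝ → ℝ}
    (hf : Continuous f) :
    ∑ k : Fin n, ∫ x in u k..u (k + 1), f x = ∫ x in u 0..u 0 + π, f x := by
  rw [Fin.sum_univ_eq_sum_range (fun k => ∫ x in u k..u (k + 1), f x) n,
    intervalIntegral.sum_integral_adjacent_intervals fun k _ => hf.intervalIntegrable _ _, hun]

/-- The energy of a sum of functions `|sin|` with `n` nodes, compared to its mean, with the
equality case. -/
theorem sq_integral_sineSum_le {n : ℕ} (hn : 0 < n) {u : ℕ → ℝ} (w : ℕ → ℝ) (hu : Monotone u)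
    (hun : u n = u 0 + π) :
    (∫ x in u 0..u 0 + π, sineSum n u w x) ^ 2 ≤
        (∫ x in u 0..u 0 + π, sineSum n u w x ^ 2) * (n * arcGain (π / n)) ∧
      ((∫ x in u 0..u 0 + π, sineSum n u w x) ≠ 0 →
        (∫ x in u 0..u 0 + π, sineSum n u w x) ^ 2 =
          (∫ x in u 0..u 0 + π, sineSum n u w x ^ 2) * (n * arcGain (π / n)) →
        (∀ k ≤ n, u k = u 0 + k * (π / n)) ∧
          ∃ x₀, ∀ k ≤ n, sineSum n u w (u k) = x₀) := by
  set X := sineSum n u w with hX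
  have hXc : Continuous X := continuous_sineSum n u w
  have hn' : (0 : ℝ) < n := Nat.cast_pos.2 hn
  have ht0 : ∀ k : Fin n, 0 ≤ u (k + 1) - u k := fun k => sub_nonneg.2 (hu (Nat.le_succ k))
  have htπ : ∀ k : Fin n, u (k + 1) - u k ≤ π := fun k => arc_le_pi hu hun k.2
  choose a b hab using fun k : Fin n => exists_sinusoid w hu hun k.2
  obtain ⟨hΦle, hΦeq⟩ := sum_arcGain_le hn (fun k : Fin n => u (k + 1) - u k) ht0 (sum_arcs hun)
  set Φ := ∑ k : Fin n, arcGain (u (k + 1) - u k) with hΦ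
  have hΦ0 : 0 < Φ := by
    obtain ⟨k, hk⟩ : ∃ k : Fin n, 0 < u (k + 1) - u k := by
      by_contra! h
      have h1 := Finset.sum_nonpos fun k (_ : k ∈ Finset.univ) => h k
      rw [sum_arcs hun] at h1
      exact absurd h1 (not_le.2 Real.pi_pos)
    exact Finset.sum_pos' (fun j _ => arcGain_nonneg (ht0 j) (htπ j))
      ⟨k, Finset.mem_univ _, arcGain_pos hk (htπ k)⟩
  set I := ∫ x in u 0..u 0 + π, X x with hI
  set S := ∫ x in u 0..u 0 + π, X x ^ 2 with hS
  -- The quadratic `S - 2 c I + c² Φ` is minimal at `c = I / Φ`, with value `S - I² / Φ`. For this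
  -- `c`, `E k` is the completed square on the `k`-th arc.
  set E : Fin n → ℝ := fun k => (u (k + 1) - u k + Real.sin (u (k + 1) - u k)) / 2 *
        (a k - I / Φ * (4 * Real.sin ((u (k + 1) - u k) / 2) /
          (u (k + 1) - u k + Real.sin (u (k + 1) - u k)))) ^ 2 +
      b k ^ 2 * ((u (k + 1) - u k - Real.sin (u (k + 1) - u k)) / 2) with hE
  have hE0 : ∀ k ∈ Finset.univ, 0 ≤ E k := fun k _ => by
    refine add_nonneg (mul_nonneg (div_nonneg (add_nonneg (ht0 k) ?_) zero_le_two) (sq_nonneg _))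
      (mul_nonneg (sq_nonneg _) (div_nonneg (sin_le_of_nonneg (ht0 k)) zero_le_two))
    exact Real.sin_nonneg_of_nonneg_of_le_pi (ht0 k) (htπ k)
  have hkey : S - I ^ 2 / Φ = ∑ k, E k := by
    have hsum : ∑ k, E k = S - 2 * (I / Φ) * I + (I / Φ) ^ 2 * Φ := by
      have hIs : I = ∑ k : Fin n, ∫ x in u k..u (k + 1), X x := (sum_integral_arcs hun hXc).symm
      have hSs : S = ∑ k : Fin n, ∫ x in u k..u (k + 1), X x ^ 2 :=
        (sum_integral_arcs hun (hXc.pow 2)).symm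
      simp only [hE]
      generalize I / Φ = c
      rw [hIs, hSs, hΦ, Finset.mul_sum, Finset.mul_sum, ← Finset.sum_sub_distrib,
        ← Finset.sum_add_distrib]
      refine Finset.sum_congr rfl fun k _ => ?_
      rw [← sinusoid_completeSquare _ _ _ (hu (Nat.le_succ k)) (htπ k)]
      have h1 : ∀ ω ∈ Set.uIcc (u k) (u (k + 1)), X ω = _ := fun ω hω =>
        hab k ω (by rwa [Set.uIcc_of_le (hu (Nat.le_succ k))] at hω)
      rw [intervalIntegral.integral_congr h1,
        intervalIntegral.integral_congr fun ω hω => congrArg (· ^ 2) (h1 ω hω)]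
    rw [hsum]
    field_simp
    ring
  have hSΦ : I ^ 2 / Φ ≤ S := by
    have := Finset.sum_nonneg hE0
    linarith
  have hS0 : 0 ≤ S := (by positivity : 0 ≤ I ^ 2 / Φ).trans hSΦ
  rw [div_le_iff₀ hΦ0] at hSΦ
  refine ⟨hSΦ.trans (mul_le_mul_of_nonneg_left hΦle hS0), fun hI0 heq => ?_⟩
  have hI2 : 0 < I ^ 2 := by positivity
  have hS1 : 0 < S := by
    rcases hS0.eq_or_lt with h | h
    · rw [← h, zero_mul] at heq
      exact absurd heq hI2.ne'
    · exact h
  -- Equality in `I² ≤ S Φ ≤ S n arcGain (π / n)` with `S > 0` makes Jensen sharp; then every `E k`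
  -- vanishes as well.
  have hΦe : Φ = n * arcGain (π / n) :=
    le_antisymm hΦle (le_of_mul_le_mul_left (heq ▸ hSΦ) hS1)
  have ht := hΦeq hΦe
  have hEz : ∀ k, E k = 0 := by
    have : ∑ k, E k = 0 := by
      rw [← hkey, heq, ← hΦe, mul_div_cancel_right₀ _ hΦ0.ne', sub_self]
    intro k
    exact (Finset.sum_eq_zero_iff_of_nonneg hE0).1 this k (Finset.mem_univ k)
  have hπn : 0 < π / n := div_pos Real.pi_pos hn'
  have hπn1 : π / n ≤ π := div_le_self Real.pi_pos.le (Nat.one_le_cast.2 hn)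
  set A := I / Φ * (4 * Real.sin (π / n / 2) / (π / n + Real.sin (π / n))) with hA
  have hcoef : ∀ k, a k = A ∧ b k = 0 := by
    intro k
    have hz := hEz k
    simp only [hE, ht k] at hz
    have hP : 0 < (π / n + Real.sin (π / n)) / 2 := half_pos (add_sin_pos hπn hπn1)
    have hM : 0 < (π / n - Real.sin (π / n)) / 2 := half_pos (sub_pos.2 (Real.sin_lt hπn))
    have h1 := mul_nonneg hP.le (sq_nonneg (a k - A))
    have h2 := mul_nonneg (sq_nonneg (b k)) hM.le
    have h3 : (π / n + Real.sin (π / n)) / 2 * (a k - A) ^ 2 = 0 := by linarith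
    have h4 : b k ^ 2 * ((π / n - Real.sin (π / n)) / 2) = 0 := by linarith
    refine ⟨?_, ?_⟩
    · simpa [hP.ne', sub_eq_zero] using h3
    · simpa [hM.ne'] using h4
  refine ⟨?_, A * Real.cos (π / n / 2), ?_⟩
  · intro k hk
    induction k with
    | zero => simp
    | succ k ih =>
      have h1 := ht ⟨k, hk⟩
      have h2 := ih (Nat.le_of_succ_le hk)
      simp only at h1
      push_cast
      linarith
  -- On each arc `X` is `A` times the cosine centred at the midpoint, and both endpoints lie at
  -- distance `π / n / 2` from it.
  · have hval : ∀ k : Fin n, X (u k) = A * Real.cos (π / n / 2) ∧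
        X (u (k + 1)) = A * Real.cos (π / n / 2) := by
      intro k
      have hle := hu (Nat.le_succ k)
      have h1 := ht k
      rw [hX, hab k _ ⟨le_rfl, hle⟩, hab k _ ⟨hle, le_rfl⟩, (hcoef k).1, (hcoef k).2,
        ← Real.cos_neg (u k - _)]
      have e1 : -(u k - (u k + u (k + 1)) / 2) = π / n / 2 := by linarith
      have e2 : u (k + 1) - (u k + u (k + 1)) / 2 = π / n / 2 := by linarith
      rw [e1, e2]
      simp
    intro k hk
    rcases hk.eq_or_lt with rfl | hk
    · obtain ⟨m, rfl⟩ := Nat.exists_eq_succ_of_ne_zero hn.ne'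
      exact (hval ⟨m, Nat.lt_succ_self m⟩).2
    · exact (hval ⟨k, hk⟩).1

/-- With equidistant nodes, the weights are second differences. -/
theorem second_difference_sineSum {n : ℕ} (hn : 0 < n) {u : ℕ → ℝ} (w : ℕ → ℝ)
    (hu : ∀ k ≤ n, u k = u 0 + k * (π / n)) {k : ℕ} (hk : k < n) :
    sineSum n u w (u k + π / n) + sineSum n u w (u k - π / n) -
      2 * Real.cos (π / n) * sineSum n u w (u k) = 2 * Real.sin (π / n) * w k := by
  have hn' : (0 : ℝ) < n := Nat.cast_pos.2 hn
  have hd : 0 < π / n := div_pos Real.pi_pos hn'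
  have hd1 : π / n ≤ π := div_le_self Real.pi_pos.le (Nat.one_le_cast.2 hn)
  have hnd : n * (π / n) = π := by field_simp
  have hsd := Real.sin_nonneg_of_nonneg_of_le_pi hd.le hd1
  set d := π / n with hdef
  unfold sineSum
  rw [Finset.mul_sum, ← Finset.sum_add_distrib, ← Finset.sum_sub_distrib,
    Finset.sum_eq_single_of_mem k (Finset.mem_range.2 hk)]
  · rw [add_sub_cancel_left, sub_sub_cancel_left, sub_self, Real.sin_neg, abs_neg,
      abs_of_nonneg hsd, Real.sin_zero]
    simp
    ring
  -- For `j ≠ k` the three points stay within one half turn on one side of `u j`, so the sine has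
  -- constant sign there and `sin (x + d) + sin (x - d) = 2 cos d sin x` cancels the term.
  · intro j hj hjk
    have hj' := Finset.mem_range.1 hj
    rw [hu k hk.le, hu j hj'.le]
    rcases hjk.lt_or_gt with h | h
    · have h1 : ((j : ℝ) + 1) * d ≤ k * d :=
        mul_le_mul_of_nonneg_right (by exact_mod_cast h) hd.le
      have h2 : ((k : ℝ) + 1) * d ≤ n * d :=
        mul_le_mul_of_nonneg_right (by exact_mod_cast hk) hd.le
      have h3 : 0 ≤ (j : ℝ) * d := by positivity
      rw [abs_of_nonneg (Real.sin_nonneg_of_nonneg_of_le_pi (by linarith) (by linarith)),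
        abs_of_nonneg (Real.sin_nonneg_of_nonneg_of_le_pi (by linarith) (by linarith)),
        abs_of_nonneg (Real.sin_nonneg_of_nonneg_of_le_pi (by linarith) (by linarith)),
        add_sub_right_comm _ d, sub_right_comm _ d, Real.sin_add, Real.sin_sub _ d]
      ring
    · have h1 : ((k : ℝ) + 1) * d ≤ j * d :=
        mul_le_mul_of_nonneg_right (by exact_mod_cast h) hd.le
      have h2 : ((j : ℝ) + 1) * d ≤ n * d :=
        mul_le_mul_of_nonneg_right (by exact_mod_cast hj') hd.le
      have h3 : 0 ≤ (k : ℝ) * d := by positivity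
      rw [abs_of_nonpos (Real.sin_nonpos_of_nonpos_of_neg_pi_le (by linarith) (by linarith)),
        abs_of_nonpos (Real.sin_nonpos_of_nonpos_of_neg_pi_le (by linarith) (by linarith)),
        abs_of_nonpos (Real.sin_nonpos_of_nonpos_of_neg_pi_le (by linarith) (by linarith)),
        add_sub_right_comm _ d, sub_right_comm _ d, Real.sin_add, Real.sin_sub _ d]
      ring

/-- Modulo the period `π` the neighbours of a node are again nodes, so every second difference is
the same constant. Since `n ≥ 2`, the factor `sin (π / n)` can be divided out. -/
theorem weights_eq_of_values_eq {n : ℕ} (hn : 2 ≤ n) {u : ℕ → ℝ} (w : ℕ → ℝ)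
    (hu : ∀ k ≤ n, u k = u 0 + k * (π / n)) {x₀ : ℝ}
    (hx : ∀ k ≤ n, sineSum n u w (u k) = x₀) {k l : ℕ} (hk : k < n) (hl : l < n) :
    w k = w l := by
  have hn0 : 0 < n := by omega
  have hn' : (0 : ℝ) < n := Nat.cast_pos.2 hn0
  have hd : 0 < π / n := div_pos Real.pi_pos hn'
  have hd1 : π / n < π := div_lt_self Real.pi_pos (Nat.one_lt_cast.2 hn)
  have hnd : n * (π / n) = π := by field_simp
  have hs := Real.sin_pos_of_pos_of_lt_pi hd hd1
  have key : ∀ k < n, 2 * Real.sin (π / n) * w k = 2 * x₀ - 2 * Real.cos (π / n) * x₀ := by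
    intro k hk
    rw [← second_difference_sineSum hn0 w hu hk, hx k hk.le]
    have h1 : u k + π / n = u (k + 1) := by
      rw [hu k hk.le, hu (k + 1) hk]
      push_cast
      ring
    have h2 : sineSum n u w (u k - π / n) = x₀ := by
      -- The left neighbour of node `0` is node `n - 1` moved back by `π`.
      rcases Nat.eq_zero_or_pos k with rfl | h0
      · rw [← periodic_sineSum n u w, ← hx (n - 1) (Nat.sub_le _ _), hu (n - 1) (Nat.sub_le _ _),
          Nat.cast_pred hn0]
        congr 1
        linarith
      · rw [← hx (k - 1) (by omega), hu k hk.le, hu (k - 1) (by omega), Nat.cast_pred h0]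
        congr 1
        ring
    rw [h1, h2, hx (k + 1) hk]
    ring
  have := (key k hk).trans (key l hl).symm
  exact mul_left_cancel₀ (by positivity) this

/-! ### Equidistant nodes -/

/-- All the sines are nonnegative in this range; multiplied by `sin (π / n / 2)` they become a
telescoping sum of cosines. -/
theorem sum_abs_sin_equidistant {n : ℕ} (hn : 0 < n) {x : ℝ} (h0 : 0 ≤ x) (h1 : x ≤ π / n) :
    ∑ j ∈ Finset.range n, |Real.sin (x + j * (π / n))| =
      (Real.sin (π / n / 2))⁻¹ * Real.cos (x - π / n / 2) := by
  have hn' : (0 : ℝ) < n := Nat.cast_pos.2 hn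
  have hd : 0 < π / n := div_pos Real.pi_pos hn'
  have hd1 : π / n ≤ π := div_le_self Real.pi_pos.le (Nat.one_le_cast.2 hn)
  have hnd : n * (π / n) = π := by field_simp
  set d := π / n
  have hs : 0 < Real.sin (d / 2) := Real.sin_pos_of_pos_of_lt_pi (by linarith) (by linarith)
  rw [inv_mul_eq_div, eq_div_iff hs.ne', Finset.sum_mul]
  have : ∀ j ∈ Finset.range n, |Real.sin (x + j * d)| * Real.sin (d / 2) =
      (fun i : ℕ => -(Real.cos (x - d / 2 + i * d) / 2)) (j + 1) -
        (fun i : ℕ => -(Real.cos (x - d / 2 + i * d) / 2)) j := by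
    intro j hj
    have h2 : ((j : ℝ) + 1) * d ≤ n * d :=
      mul_le_mul_of_nonneg_right (by exact_mod_cast Finset.mem_range.1 hj) hd.le
    have h3 : 0 ≤ (j : ℝ) * d := by positivity
    rw [abs_of_nonneg (Real.sin_nonneg_of_nonneg_of_le_pi (by linarith) (by linarith))]
    have e1 : x - d / 2 + ((j + 1 : ℕ) : ℝ) * d = x + j * d + d / 2 := by push_cast; ring
    have e2 : x - d / 2 + (j : ℝ) * d = x + j * d - d / 2 := by ring
    simp only [e1, e2, Real.cos_add (x + j * d), Real.cos_sub (x + j * d)]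
    ring
  rw [Finset.sum_congr rfl this,
    Finset.sum_range_sub (fun i : ℕ => -(Real.cos (x - d / 2 + i * d) / 2))]
  simp only [hnd, Nat.cast_zero, zero_mul, add_zero, Real.cos_add_pi]
  ring

/-! ### Expectations as integrals -/

theorem expectation_eq_integral (X : ℝ → ℝ) :
    expectation X = (2 * π)⁻¹ * ∫ ω in (-π)..π, X ω := by
  have hπ := Real.pi_pos
  rw [expectation, directionMeasure, ProbabilityTheory.cond, integral_smul_measure,
    intervalIntegral.integral_of_le (by linarith), Real.volume_Ioc, ENNReal.toReal_inv,
    ENNReal.toReal_ofReal (by linarith), smul_eq_mul, sub_neg_eq_add, two_mul]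

theorem expectation_eq_of_periodic {X : ℝ → ℝ} (hp : Function.Periodic X π) (hc : Continuous X)
    (a : ℝ) : expectation X = π⁻¹ * ∫ ω in a..a + π, X ω := by
  have h := hp.intervalIntegral_add_eq_add (-π) 0 fun _ _ => hc.intervalIntegrable _ _
  have h1 := hp.intervalIntegral_add_eq (-π) a
  have h2 := hp.intervalIntegral_add_eq (-π) (-π)
  have h3 : ∫ ω in (-π)..0, X ω = ∫ ω in a..a + π, X ω := by
    rw [← h1, neg_add_cancel]
  rw [zero_add, h3, h1] at h
  rw [expectation_eq_integral, h]
  field_simp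
  ring

theorem expectation_sub_left {X : ℝ → ℝ} (hp : Function.Periodic X (2 * π)) (φ : ℝ) :
    expectation (fun ω => X (φ - ω)) = expectation X := by
  rw [expectation_eq_integral, expectation_eq_integral,
    intervalIntegral.integral_comp_sub_left (fun x => X x)]
  have h := hp.intervalIntegral_add_eq (φ - π) (-π)
  have e1 : φ - π + 2 * π = φ - -π := by ring
  have e2 : -π + 2 * π = π := by ring
  rw [e1, e2] at h
  rw [h]

theorem expectation_const_mul (r : ℝ) (X : ℝ → ℝ) :
    expectation (fun ω => r * X ω) = r * expectation X :=
  integral_const_mul _ _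

theorem integrable_direction {X : ℝ → ℝ} (hc : Continuous X) : Integrable X directionMeasure := by
  have h : IntegrableOn X (Set.Ioc (-π) π) :=
    hc.integrableOn_Icc.mono_set Set.Ioc_subset_Icc_self
  refine Integrable.smul_measure h ?_
  rw [Real.volume_Ioc, ne_eq, ENNReal.inv_eq_top, ENNReal.ofReal_eq_zero, not_le]
  linarith [Real.pi_pos]

theorem expectation_sum {ι : Type*} (s : Finset ι) {X : ι → ℝ → ℝ}
    (hX : ∀ i ∈ s, Continuous (X i)) :
    expectation (fun ω => ∑ i ∈ s, X i ω) = ∑ i ∈ s, expectation (X i) :=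
  integral_finsetSum _ fun i hi => integrable_direction (hX i hi)

theorem deviationRate_const_mul {r : ℝ} (hr : 0 < r) (X : ℝ → ℝ) :
    deviationRate (fun ω => r * X ω) = deviationRate X := by
  simp only [deviationRate, mul_pow, expectation_const_mul, ← mul_sub]
  rw [Real.sqrt_mul (sq_nonneg r), Real.sqrt_sq hr.le, mul_div_mul_left _ _ hr.ne']

theorem deviationRate_eq_sqrt {X : ℝ → ℝ} (h : 0 < expectation X) :
    deviationRate X = √(expectation (fun ω => X ω ^ 2) / expectation X ^ 2 - 1) := by
  rw [deviationRate, div_sub_one (pow_pos h 2).ne', Real.sqrt_div' _ (sq_nonneg _),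
    Real.sqrt_sq h.le]

theorem sq_integral_le_mul_integral_sq {f : ℝ → ℝ} (hf : Continuous f) {a b : ℝ} (hab : a < b) :
    (∫ x in a..b, f x) ^ 2 ≤ (b - a) * ∫ x in a..b, f x ^ 2 := by
  have hL := sub_pos.2 hab
  set c := (∫ x in a..b, f x) / (b - a) with hc
  have h0 : 0 ≤ ∫ x in a..b, (f x - c) ^ 2 :=
    intervalIntegral.integral_nonneg hab.le fun _ _ => sq_nonneg _
  have h1 : ∫ x in a..b, (f x - c) ^ 2 =
      (∫ x in a..b, f x ^ 2) - 2 * c * (∫ x in a..b, f x) + (b - a) * c ^ 2 := by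
    have : ∀ x, (f x - c) ^ 2 = f x ^ 2 - 2 * c * f x + c ^ 2 := fun x => by ring
    simp only [this]
    rw [intervalIntegral.integral_add, intervalIntegral.integral_sub,
      intervalIntegral.integral_const_mul, intervalIntegral.integral_const, smul_eq_mul]
    all_goals exact Continuous.intervalIntegrable (by fun_prop) _ _
  have h2 : (b - a) * c = ∫ x in a..b, f x := mul_div_cancel₀ _ hL.ne'
  rw [h1, ← h2] at h0
  rw [← h2]
  nlinarith [mul_nonneg hL.le h0]

/-- Cauchy–Schwarz for the centred cosine, which attains the gain. It makes the radicand of `ν_n`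
nonnegative, so that equal square roots have equal radicands. -/
theorem arcGain_le_self {t : ℝ} (h0 : 0 < t) (h1 : t ≤ π) : arcGain t ≤ t := by
  have h := sq_integral_le_mul_integral_sq
    (f := fun x => 1 * Real.cos (x - (0 + t) / 2) + 0 * Real.sin (x - (0 + t) / 2))
    (by fun_prop) h0
  rw [integral_sinusoid, integral_sinusoid_sq, sub_zero] at h
  have hc : Real.cos t = 1 - 2 * Real.sin (t / 2) ^ 2 := by
    rw [← Real.cos_two_mul_eq_one_sub]
    congr 1; ring
  rw [arcGain, div_le_iff₀ (add_sin_pos h0 h1), hc]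
  linarith

/-! ### The number `ν_n` and equidistant nodes -/

/-- Half-angle formulas bring the closed form into the shape that the arc inequality produces. -/
theorem nu_eq {n : ℕ} (hn : 2 ≤ n) : nu n = √(π / (n * arcGain (π / n)) - 1) := by
  have hn' : (0 : ℝ) < n := Nat.cast_pos.2 (by omega)
  have hn2 : (2 : ℝ) ≤ n := by exact_mod_cast hn
  have hπ := Real.pi_pos
  have hd : 0 < π / n := div_pos hπ hn'
  have hd2 : π / n ≤ π / 2 := div_le_div_of_nonneg_left hπ.le two_pos hn2
  have hs : 0 < Real.sin (π / n / 2) := Real.sin_pos_of_pos_of_lt_pi (by linarith) (by linarith)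
  have hcs : 0 < Real.cos (π / n / 2) := Real.cos_pos_of_mem_Ioo ⟨by linarith, by linarith⟩
  have e : π / (2 * n) = π / n / 2 := by rw [div_div, mul_comm]
  have hsum := add_sin_pos hd (by linarith)
  have hcos : Real.cos (π / n) = 1 - 2 * Real.sin (π / n / 2) ^ 2 := by
    rw [← Real.cos_two_mul_eq_one_sub]
    congr 1; ring
  have hsin : Real.sin (π / n) = 2 * Real.sin (π / n / 2) * Real.cos (π / n / 2) := by
    rw [← Real.sin_two_mul]
    congr 1; ring
  rw [nu, e, arcGain, Real.tan_eq_sin_div_cos, hcos]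
  congr 2
  rw [hsin] at hsum ⊢
  have hd' : π = n * (π / n) := by field_simp
  generalize π / n = d at *
  rw [hd']
  field_simp
  ring

theorem one_le_pi_div {n : ℕ} (hn : 0 < n) : 1 ≤ π / (n * arcGain (π / n)) := by
  have hn' : (0 : ℝ) < n := Nat.cast_pos.2 hn
  have hd : 0 < π / n := div_pos Real.pi_pos hn'
  have hd1 : π / n ≤ π := div_le_self Real.pi_pos.le (Nat.one_le_cast.2 hn)
  rw [one_le_div (mul_pos hn' (arcGain_pos hd hd1))]
  calc n * arcGain (π / n) ≤ n * (π / n) :=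
        mul_le_mul_of_nonneg_left (arcGain_le_self hd hd1) hn'.le
    _ = π := by field_simp

/-- The sum has period `π / n`, so both moments reduce to a single arc, on which it is one centred
cosine. -/
theorem deviationRate_equidistant {n : ℕ} (hn : 2 ≤ n) {r : ℝ} (hr : 0 < r) (φ : ℝ) :
    deviationRate (fun ω => r * ∑ j ∈ Finset.range n, |Real.sin (φ + j * (π / n) - ω)|) =
      nu n := by
  have hn0 : 0 < n := by omega
  have hn' : (0 : ℝ) < n := Nat.cast_pos.2 hn0
  have hπ := Real.pi_pos
  have hd : 0 < π / n := div_pos hπ hn'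
  have hd1 : π / n ≤ π := div_le_self hπ.le (Nat.one_le_cast.2 hn0)
  have hnd : n * (π / n) = π := by field_simp
  rw [deviationRate_const_mul hr, nu_eq hn]
  set G : ℝ → ℝ := fun x => ∑ j ∈ Finset.range n, |Real.sin (x + j * (π / n))| with hG
  have hGc : Continuous G := by fun_prop
  have hGd : Function.Periodic G (π / n) := by
    intro x
    -- Splitting off the last or the first of `n + 1` terms gives the shift, because the terms `0`
    -- and `n` differ by `π` in argument and so agree.
    have h := (Finset.sum_range_succ (fun j : ℕ => |Real.sin (x + j * (π / n))|) n).symm.trans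
      (Finset.sum_range_succ' (fun j : ℕ => |Real.sin (x + j * (π / n))|) n)
    simp only [hnd, Real.sin_add_pi, abs_neg, Nat.cast_zero, zero_mul, add_zero] at h
    rw [hG]
    dsimp only
    rw [add_right_cancel h]
    refine Finset.sum_congr rfl fun j _ => ?_
    congr 2
    push_cast
    ring
  have hper : ∀ {H : ℝ → ℝ}, Continuous H → Function.Periodic H (π / n) →
      expectation (fun ω => H (φ - ω)) = π⁻¹ * (n * ∫ x in 0..π / n, H x) := by
    intro H hH hp
    have hp1 : Function.Periodic H π := by
      have := hp.nat_mul n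
      rwa [hnd] at this
    rw [expectation_sub_left (by simpa using hp1.nat_mul 2), expectation_eq_of_periodic hp1 hH 0]
    have h := hp.intervalIntegral_add_zsmul_eq n 0 fun _ _ => hH.intervalIntegrable _ _
    rw [zsmul_eq_mul, zsmul_eq_mul, Int.cast_natCast, hnd, zero_add (π / n)] at h
    rw [h]
  have hs : 0 < Real.sin (π / n / 2) := Real.sin_pos_of_pos_of_lt_pi (by linarith) (by linarith)
  have hval : ∀ x ∈ Set.uIcc 0 (π / n), G x = (Real.sin (π / n / 2))⁻¹ *
      Real.cos (x - (0 + π / n) / 2) + 0 * Real.sin (x - (0 + π / n) / 2) := by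
    intro x hx
    rw [Set.uIcc_of_le hd.le] at hx
    rw [hG]
    dsimp only
    rw [sum_abs_sin_equidistant hn0 hx.1 hx.2, zero_add, zero_mul, add_zero]
  have hI : ∫ x in 0..π / n, G x = 2 := by
    rw [intervalIntegral.integral_congr hval, integral_sinusoid, sub_zero,
      mul_assoc, inv_mul_cancel₀ hs.ne', mul_one]
  have hS : ∫ x in 0..π / n, G x ^ 2 =
      (Real.sin (π / n / 2))⁻¹ ^ 2 * ((π / n + Real.sin (π / n)) / 2) := by
    rw [intervalIntegral.integral_congr fun x hx => congrArg (· ^ 2) (hval x hx),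
      integral_sinusoid_sq, sub_zero]
    ring
  have hfun : (fun ω => ∑ j ∈ Finset.range n, |Real.sin (φ + j * (π / n) - ω)|) =
      fun ω => G (φ - ω) := by
    funext ω
    refine Finset.sum_congr rfl fun j _ => ?_
    rw [add_sub_right_comm]
  have hEG := hper hGc hGd
  have hEG2 := hper (H := fun x => G x ^ 2) (hGc.pow 2) fun x => congrArg (· ^ 2) (hGd x)
  rw [hI] at hEG
  rw [hS] at hEG2
  have hpos : 0 < π⁻¹ * ((n : ℝ) * 2) := by positivity
  rw [hfun, deviationRate_eq_sqrt (by rw [hEG]; exact hpos), hEG]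
  have hcos : Real.cos (π / n) = 1 - 2 * Real.sin (π / n / 2) ^ 2 := by
    rw [← Real.cos_two_mul_eq_one_sub]
    congr 1; ring
  have hP := add_sin_pos hd hd1
  rw [hEG2, arcGain, hcos]
  congr 2
  field_simp
  ring

/-! ### The lower bound -/

/-- Here `δ² + 1 = E(X²) / E(X)² = π S / I²` in terms of the integrals over one period, so the arc
inequality and its equality case transfer directly. -/
theorem nu_le_deviationRate_sineSum {n : ℕ} (hn : 2 ≤ n) {u : ℕ → ℝ} (w : ℕ → ℝ) (hu : Monotone u)
    (hun : u n = u 0 + π) (hpos : 0 < expectation (sineSum n u w)) :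
    nu n ≤ deviationRate (sineSum n u w) ∧
      (deviationRate (sineSum n u w) = nu n →
        (∀ k ≤ n, u k = u 0 + k * (π / n)) ∧ ∀ k < n, ∀ l < n, w k = w l) := by
  have hn0 : 0 < n := by omega
  have hn' : (0 : ℝ) < n := Nat.cast_pos.2 hn0
  have hπ := Real.pi_pos
  have hΦ : 0 < n * arcGain (π / n) := mul_pos hn'
    (arcGain_pos (div_pos hπ hn') (div_le_self hπ.le (Nat.one_le_cast.2 hn0)))
  have hXc := continuous_sineSum n u w
  have hXp := periodic_sineSum n u w
  have hE1 := expectation_eq_of_periodic hXp hXc (u 0)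
  have hE2 := expectation_eq_of_periodic (X := fun ω => sineSum n u w ω ^ 2)
    (fun ω => congrArg (· ^ 2) (hXp ω)) (hXc.pow 2) (u 0)
  obtain ⟨hle, heq⟩ := sq_integral_sineSum_le hn0 w hu hun
  set I := ∫ x in u 0..u 0 + π, sineSum n u w x
  set S := ∫ x in u 0..u 0 + π, sineSum n u w x ^ 2
  have hI : 0 < I := by
    rw [hE1] at hpos
    exact (mul_pos_iff_of_pos_left (inv_pos.2 hπ)).1 hpos
  have hratio : π⁻¹ * S / (π⁻¹ * I) ^ 2 = π * S / I ^ 2 := by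
    field_simp
  have hcmp : π / (n * arcGain (π / n)) ≤ π * S / I ^ 2 := by
    rw [div_le_div_iff₀ hΦ (pow_pos hI 2)]
    calc π * I ^ 2 ≤ π * (S * (n * arcGain (π / n))) := mul_le_mul_of_nonneg_left hle hπ.le
      _ = _ := by ring
  have h1 := one_le_pi_div hn0
  rw [nu_eq hn, deviationRate_eq_sqrt hpos, hE1, hE2, hratio]
  refine ⟨Real.sqrt_le_sqrt (by linarith), fun h => ?_⟩
  rw [Real.sqrt_inj (by linarith) (by linarith), sub_left_inj,
    div_eq_div_iff (pow_pos hI 2).ne' hΦ.ne', mul_assoc] at h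
  obtain ⟨h2, x₀, h3⟩ := heq hI.ne' (mul_left_cancel₀ hπ.ne' h).symm
  exact ⟨h2, fun k hk l hl => weights_eq_of_values_eq hn w h2 h3 hk hl⟩

/-! ### Half widths of families of vectors -/

/-- Half the sum of the lengths of the projections of a family of vectors. -/
noncomputable def halfWidth {ι : Type*} [Fintype ι] (a : ι → ℂ) (ω : ℝ) : ℝ :=
  ∑ j, |(a j * Complex.exp (-(ω * Complex.I))).im| / 2

theorem norm_mul_sin_arg_sub (z : ℂ) (ω : ℝ) :
    ‖z‖ * Real.sin (z.arg - ω) = (z * Complex.exp (-(ω * Complex.I))).im := by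
  conv_rhs => rw [← Complex.norm_mul_exp_arg_mul_I z]
  rw [mul_assoc, ← Complex.exp_add, ← neg_mul, ← add_mul, ← Complex.ofReal_neg,
    ← Complex.ofReal_add, Complex.im_ofReal_mul, Complex.exp_ofReal_mul_I_im, sub_eq_add_neg]

theorem sum_edge {n : ℕ} (α : Fin n → ℂ) : ∑ j, edge α j = 0 := by
  simp only [edge, Finset.sum_sub_distrib, Equiv.sum_comp (finRotate n) α, sub_self]

/-- `max x 0 = (x + |x|) / 2`, and the linear parts cancel because the edges sum to zero. -/
theorem shadow_eq_halfWidth {n : ℕ} (α : Fin n → ℂ) : shadow α = halfWidth (edge α) := by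
  funext ω
  have h0 : ∑ j, (edge α j * Complex.exp (-(ω * Complex.I))).im = 0 := by
    rw [← Complex.im_sum, ← Finset.sum_mul, sum_edge, zero_mul, Complex.zero_im]
  have h : ∀ j, vectorShadow (edge α j) ω =
      (edge α j * Complex.exp (-(ω * Complex.I))).im / 2 +
        |(edge α j * Complex.exp (-(ω * Complex.I))).im| / 2 := by
    intro j
    rw [vectorShadow, mul_max_of_nonneg _ _ (norm_nonneg _), mul_zero, norm_mul_sin_arg_sub,
      ← add_div]
    rcases le_total 0 (edge α j * Complex.exp (-(ω * Complex.I))).im with h | h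
    · rw [max_eq_left h, abs_of_nonneg h, add_self_div_two]
    · rw [max_eq_right h, abs_of_nonpos h, add_neg_cancel, zero_div]
  simp only [shadow, h, Finset.sum_add_distrib, ← Finset.sum_div, h0, zero_div, zero_add,
    halfWidth]

theorem PreEdgeBundle.shadow_eq_halfWidth {m : ℕ} (B : PreEdgeBundle m) :
    B.shadow = halfWidth B.preEdge := by
  funext ω
  refine Finset.sum_congr rfl fun j _ => ?_
  rw [← norm_mul_sin_arg_sub, abs_mul, abs_norm]
  ring

theorem halfWidth_congr {ι : Type*} [Fintype ι] {a b : ι → ℂ}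
    (h : ∀ j, b j = a j ∨ b j = -a j) : halfWidth b = halfWidth a := by
  funext ω
  refine Finset.sum_congr rfl fun j _ => ?_
  rcases h j with h | h
  · rw [h]
  · rw [h, neg_mul, Complex.neg_im, abs_neg]

theorem halfWidth_comp_equiv {ι κ : Type*} [Fintype ι] [Fintype κ] (e : κ ≃ ι) (a : ι → ℂ) :
    halfWidth (a ∘ e) = halfWidth a := by
  funext ω
  exact Equiv.sum_comp e fun j => |(a j * Complex.exp (-(ω * Complex.I))).im| / 2

theorem halfWidth_eq_of_range_eq {ι κ : Type*} [Fintype ι] [Fintype κ] {a : ι → ℂ} {b : κ → ℂ}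
    (ha : Function.Injective a) (hb : Function.Injective b) (h : Set.range a = Set.range b) :
    halfWidth a = halfWidth b := by
  have he := halfWidth_comp_equiv
    ((Equiv.ofInjective a ha).trans ((Equiv.setCongr h).trans (Equiv.ofInjective b hb).symm)) b
  rw [← he]
  congr 1
  funext j
  exact (congrArg Subtype.val ((Equiv.ofInjective b hb).apply_symm_apply
    (Equiv.setCongr h (Equiv.ofInjective a ha j)))).symm

/-! ### Moments of half widths -/

theorem expectation_abs_sin_pos : 0 < expectation fun ω => |Real.sin ω| := by
  have hp : Function.Periodic (fun ω => |Real.sin ω|) π := fun ω => by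
    simp only [Real.sin_add_pi, abs_neg]
  rw [expectation_eq_of_periodic hp (by fun_prop) 0, zero_add]
  refine mul_pos (inv_pos.2 Real.pi_pos) ?_
  refine intervalIntegral.intervalIntegral_pos_of_pos_on
    (Continuous.intervalIntegrable (by fun_prop) _ _) (fun x hx => ?_) Real.pi_pos
  exact abs_pos.2 (Real.sin_pos_of_mem_Ioo hx).ne'

theorem expectation_abs_im (z : ℂ) :
    expectation (fun ω => |(z * Complex.exp (-(ω * Complex.I))).im|) =
      ‖z‖ * expectation fun ω => |Real.sin ω| := by
  simp only [← norm_mul_sin_arg_sub, abs_mul, abs_norm]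
  rw [expectation_const_mul,
    expectation_sub_left (X := fun ω => |Real.sin ω|) fun ω => by simp only [Real.sin_add_two_pi]]

theorem expectation_halfWidth {ι : Type*} [Fintype ι] (a : ι → ℂ) :
    expectation (halfWidth a) = (∑ j, ‖a j‖) * ((1 / 2) * expectation fun ω => |Real.sin ω|) := by
  have h := expectation_sum (Finset.univ : Finset ι)
    (X := fun j (ω : ℝ) => (1 / 2) * |(a j * Complex.exp (-(ω * Complex.I))).im|)
    fun j _ => by fun_prop
  have e : halfWidth a = fun ω : ℝ => ∑ j, (1 / 2) * |(a j * Complex.exp (-(ω * Complex.I))).im| := by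
    funext ω
    exact Finset.sum_congr rfl fun j _ => by ring
  rw [e, h, Finset.sum_mul]
  refine Finset.sum_congr rfl fun j _ => ?_
  rw [expectation_const_mul, expectation_abs_im]
  ring

theorem expectation_halfWidth_pos {ι : Type*} [Fintype ι] {a : ι → ℂ} {i : ι} (h : a i ≠ 0) :
    0 < expectation (halfWidth a) := by
  rw [expectation_halfWidth]
  exact mul_pos (Finset.sum_pos' (fun j _ => norm_nonneg _)
    ⟨i, Finset.mem_univ i, norm_pos_iff.2 h⟩) (mul_pos one_half_pos expectation_abs_sin_pos)

theorem im_mul_im_rotate (z w : ℂ) (ω : ℝ) :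
    (z * Complex.exp (-(ω * Complex.I))).im * (w * Complex.exp (-(ω * Complex.I))).im =
      (1 / 2) * ((z * (starRingEnd ℂ) w).re - ‖z * w‖ * Real.cos (2 * ((z * w).arg / 2 - ω))) := by
  have h1 : ∀ x y : ℂ, x.im * y.im = (1 / 2) * ((x * (starRingEnd ℂ) y).re - (x * y).re) := by
    intro x y
    simp only [Complex.mul_re, Complex.conj_re, Complex.conj_im]
    ring
  have h2 : Complex.exp (-(ω * Complex.I)) *
      (starRingEnd ℂ) (Complex.exp (-(ω * Complex.I))) = 1 := by
    rw [← Complex.exp_conj, ← Complex.exp_add]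
    simp
  have h3 : (z * Complex.exp (-(ω * Complex.I)) * (w * Complex.exp (-(ω * Complex.I)))).re =
      ‖z * w‖ * Real.cos (2 * ((z * w).arg / 2 - ω)) := by
    have e : z * Complex.exp (-(ω * Complex.I)) * (w * Complex.exp (-(ω * Complex.I))) =
        (‖z * w‖ : ℂ) * Complex.exp ((2 * ((z * w).arg / 2 - ω) : ℝ) * Complex.I) := by
      have e2 : (((2 * ((z * w).arg / 2 - ω) : ℝ) : ℂ) * Complex.I) =
          (z * w).arg * Complex.I + (-(ω * Complex.I) + -(ω * Complex.I)) := by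
        push_cast
        ring
      rw [e2, Complex.exp_add, ← mul_assoc (‖z * w‖ : ℂ), Complex.norm_mul_exp_arg_mul_I,
        Complex.exp_add]
      ring
    rw [e, Complex.re_ofReal_mul, Complex.exp_ofReal_mul_I_re]
  rw [h1, h3, map_mul, mul_mul_mul_comm, h2, mul_one]

/-- The product depends on `arg (z * w)` only through a translation of `ω`, which averaging removes.
What remains are the two norms and the real inner product. -/
theorem expectation_abs_im_mul_abs_im (z w : ℂ) :
    expectation (fun ω => |(z * Complex.exp (-(ω * Complex.I))).im| *
        |(w * Complex.exp (-(ω * Complex.I))).im|) =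
      expectation fun ω => |(1 / 2) * ((z * (starRingEnd ℂ) w).re -
        ‖z‖ * ‖w‖ * Real.cos (2 * ω))| := by
  simp only [← abs_mul, im_mul_im_rotate, norm_mul]
  refine expectation_sub_left (X := fun ω => |(1 / 2) * ((z * (starRingEnd ℂ) w).re -
        ‖z‖ * ‖w‖ * Real.cos (2 * ω))|) (fun ω => ?_) _
  have : 2 * (ω + 2 * π) = 2 * ω + 2 * π + 2 * π := by ring
  simp only [this, Real.cos_add_two_pi]

theorem expectation_halfWidth_sq {ι : Type*} [Fintype ι] (a : ι → ℂ) :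
    expectation (fun ω => halfWidth a ω ^ 2) =
      ∑ j, ∑ k, (1 / 4) * expectation fun ω => |(1 / 2) * ((a j * (starRingEnd ℂ) (a k)).re -
        ‖a j‖ * ‖a k‖ * Real.cos (2 * ω))| := by
  have e : (fun ω => halfWidth a ω ^ 2) = fun ω : ℝ => ∑ j, ∑ k, (1 / 4) *
      (|(a j * Complex.exp (-(ω * Complex.I))).im| *
        |(a k * Complex.exp (-(ω * Complex.I))).im|) := by
    funext ω
    rw [halfWidth, sq, Finset.sum_mul_sum]
    exact Finset.sum_congr rfl fun j _ => Finset.sum_congr rfl fun k _ => by ring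
  rw [e, expectation_sum Finset.univ fun j _ => by fun_prop]
  refine Finset.sum_congr rfl fun j _ => ?_
  rw [expectation_sum Finset.univ fun j _ => by fun_prop]
  refine Finset.sum_congr rfl fun k _ => ?_
  rw [expectation_const_mul, expectation_abs_im_mul_abs_im]

/-- The deviation rate of a half width only depends on the Gram matrix up to scaling. -/
theorem deviationRate_halfWidth_congr {ι : Type*} [Fintype ι] {a b : ι → ℂ} {r : ℝ} (hr : 0 < r)
    (hnorm : ∀ j, ‖a j‖ = r * ‖b j‖)
    (hre : ∀ j k, (a j * (starRingEnd ℂ) (a k)).re = r ^ 2 * (b j * (starRingEnd ℂ) (b k)).re) :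
    deviationRate (halfWidth a) = deviationRate (halfWidth b) := by
  have h1 : expectation (halfWidth a) = r * expectation (halfWidth b) := by
    rw [expectation_halfWidth, expectation_halfWidth]
    simp only [hnorm, ← Finset.mul_sum]
    ring
  have h2 : expectation (fun ω => halfWidth a ω ^ 2) =
      r ^ 2 * expectation (fun ω => halfWidth b ω ^ 2) := by
    rw [expectation_halfWidth_sq, expectation_halfWidth_sq, Finset.mul_sum]
    refine Finset.sum_congr rfl fun j _ => ?_
    rw [Finset.mul_sum]
    refine Finset.sum_congr rfl fun k _ => ?_
    rw [mul_left_comm, ← expectation_const_mul (r ^ 2)]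
    congr 2
    funext ω
    rw [hnorm, hnorm, hre, ← abs_of_pos (pow_pos hr 2), ← abs_mul, abs_of_pos (pow_pos hr 2)]
    congr 1
    ring
  rw [deviationRate, deviationRate, h1, h2, mul_pow, ← mul_sub, Real.sqrt_mul (sq_nonneg r),
    Real.sqrt_sq hr.le, mul_div_mul_left _ _ hr.ne']

/-- `Similar` supplies only distances and admits reflections. Polarization recovers inner products
of edges from distances of vertices, so the Gram matrix scales by `r ^ 2`. -/
theorem deviationRate_shadow_of_similar {n : ℕ} {α α' : Fin n → ℂ} (h : Similar α α') :
    deviationRate (shadow α) = deviationRate (shadow α') := by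
  obtain ⟨r, hr, hd⟩ := similar_iff_exists_pos_dist_eq.1 h
  simp only [dist_eq_norm] at hd
  rw [shadow_eq_halfWidth, shadow_eq_halfWidth]
  refine deviationRate_halfWidth_congr hr (fun j => hd _ _) fun j k => ?_
  have hpol : ∀ p q s t : ℂ, ((p - q) * (starRingEnd ℂ) (s - t)).re =
      (‖p - t‖ ^ 2 + ‖q - s‖ ^ 2 - ‖p - s‖ ^ 2 - ‖q - t‖ ^ 2) / 2 := by
    intro p q s t
    simp only [← Complex.normSq_eq_norm_sq, Complex.normSq_apply, Complex.mul_re, Complex.conj_re,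
      Complex.conj_im, Complex.sub_re, Complex.sub_im]
    ring
  simp only [edge, hpol, hd, mul_pow]
  ring

/-! ### Representatives modulo sign -/

theorem iota_eq_or (z : ℂ) : iota z = z ∨ iota z = -z := by
  unfold iota
  split_ifs <;> simp

theorem iota_mem_upperHalf (z : ℂ) : iota z ∈ upperHalf := by
  unfold iota
  split_ifs with h
  · exact h
  · simp only [upperHalf, Set.mem_ofPred_eq, not_or, not_and, not_lt, not_le, Complex.neg_im,
      Complex.neg_re] at h ⊢
    rcases h.1.lt_or_eq with h1 | h1
    · left; linarith
    · right; exact ⟨by linarith, by linarith [h.2 h1]⟩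

theorem norm_iota (z : ℂ) : ‖iota z‖ = ‖z‖ := by
  rcases iota_eq_or z with h | h <;> simp [h]

theorem iota_ne_zero {z : ℂ} (h : z ≠ 0) : iota z ≠ 0 := by
  rwa [← norm_ne_zero_iff, norm_iota, norm_ne_zero_iff]

theorem arg_mem_Ico_of_mem_upperHalf {z : ℂ} (h : z ∈ upperHalf) : z.arg ∈ Set.Ico 0 π := by
  refine ⟨Complex.arg_nonneg_iff.2 ?_, lt_of_le_of_ne (Complex.arg_le_pi z) fun h1 => ?_⟩
  · rcases h with h | h
    · exact h.le
    · exact h.1.ge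
  · rw [Complex.arg_eq_pi_iff] at h1
    rcases h with h | h
    · exact h.ne' h1.2
    · exact (not_lt.2 h.2) h1.1

theorem halfWidth_iota {ι : Type*} [Fintype ι] (a : ι → ℂ) :
    halfWidth (fun j => iota (a j)) = halfWidth a :=
  halfWidth_congr fun j => iota_eq_or (a j)

/-! ### The lower bound for half widths -/

/-- The family is, up to signs and order, a regular fan of vectors of length `r`. -/
def IsRegularFan {n : ℕ} (a : Fin n → ℂ) (r φ : ℝ) (σ : Equiv.Perm (Fin n)) : Prop :=
  ∀ k : Fin n, ‖a (σ k)‖ = r ∧ (iota (a (σ k))).arg = φ + (k : ℕ) * (π / n)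

theorem nu_le_deviationRate_halfWidth {n : ℕ} (hn : 2 ≤ n) {a : Fin n → ℂ} (ha : ∀ j, a j ≠ 0) :
    nu n ≤ deviationRate (halfWidth a) ∧ (deviationRate (halfWidth a) = nu n →
      ∃ r φ : ℝ, 0 < r ∧ ∃ σ, IsRegularFan a r φ σ) := by
  have hn0 : 0 < n := by omega
  set ψ : Fin n → ℝ := fun j => (iota (a j)).arg with hψ
  have hψm : ∀ j, ψ j ∈ Set.Ico 0 π := fun j =>
    arg_mem_Ico_of_mem_upperHalf (iota_mem_upperHalf (a j))
  set σ := Tuple.sort ψ with hσ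
  have hmono : Monotone (ψ ∘ σ) := Tuple.monotone_sort ψ
  -- From index `n` on, `u` stays at the closing node `u 0 + π`, which keeps it monotone on all of
  -- `ℕ`.
  set u : ℕ → ℝ := fun k => if h : k < n then ψ (σ ⟨k, h⟩) else ψ (σ ⟨0, hn0⟩) + π with hu
  set w : ℕ → ℝ := fun k => if h : k < n then ‖a (σ ⟨k, h⟩)‖ / 2 else 0 with hw
  have huk : ∀ k : Fin n, u k = ψ (σ k) := fun k => dif_pos k.2
  have hwk : ∀ k : Fin n, w k = ‖a (σ k)‖ / 2 := fun k => dif_pos k.2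
  have humono : Monotone u := by
    intro i j hij
    simp only [hu]
    split_ifs with h1 h2 h2
    · exact hmono (show (⟨i, h1⟩ : Fin n) ≤ ⟨j, h2⟩ from hij)
    · linarith [(hψm (σ ⟨i, h1⟩)).2, (hψm (σ ⟨0, hn0⟩)).1]
    · omega
    · exact le_rfl
  have hun : u n = u 0 + π := by simp [hu, hn0]
  have hX : halfWidth a = sineSum n u w := by
    funext ω
    rw [← halfWidth_iota, ← halfWidth_comp_equiv σ, sineSum,
      ← Fin.sum_univ_eq_sum_range (fun k => w k * |Real.sin (ω - u k)|)]
    refine Finset.sum_congr rfl fun k _ => ?_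
    rw [huk, hwk, Function.comp_apply, ← norm_mul_sin_arg_sub, abs_mul, abs_norm, norm_iota,
      ← abs_neg (Real.sin (ω - _)), ← Real.sin_neg, neg_sub]
    ring
  have hpos : 0 < expectation (sineSum n u w) := hX ▸ expectation_halfWidth_pos (ha ⟨0, hn0⟩)
  obtain ⟨h1, h2⟩ := nu_le_deviationRate_sineSum hn w humono hun hpos
  rw [hX]
  refine ⟨h1, fun h => ?_⟩
  obtain ⟨h3, h4⟩ := h2 h
  refine ⟨‖a (σ ⟨0, hn0⟩)‖, u 0, norm_pos_iff.2 (ha _), σ, fun k => ⟨?_, ?_⟩⟩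
  · have := h4 k k.2 0 hn0
    rw [hwk, hwk ⟨0, hn0⟩] at this
    linarith
  · rw [← h3 k k.2.le, huk]

/-! ### Regular bundles -/

theorem abs_sin_add_int_mul_pi (x : ℝ) (z : ℤ) : |Real.sin (x + z * π)| = |Real.sin x| := by
  rw [Real.sin_add_int_mul_pi, abs_mul, abs_neg_one_zpow, one_mul]

theorem finRotate_val_of_lt {n : ℕ} {j : Fin n} (h : (j : ℕ) + 1 < n) :
    finRotate n j = ⟨j + 1, h⟩ := by
  obtain ⟨m, rfl⟩ := Nat.exists_eq_succ_of_ne_zero (by omega : n ≠ 0)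
  exact finRotate_of_lt (by omega)

theorem finRotate_val_of_eq {n : ℕ} {j : Fin n} (h : (j : ℕ) + 1 = n) :
    finRotate n j = ⟨0, by omega⟩ := by
  obtain ⟨m, rfl⟩ := Nat.exists_eq_succ_of_ne_zero (by omega : n ≠ 0)
  have hj : j = ⟨m, m.lt_succ_self⟩ := Fin.ext (by simpa using h)
  exact (congrArg (finRotate (m + 1)) hj).trans finRotate_last'

/-- The arguments are `k * (π / n)` past the first one up to multiples of `π`, to which `|sin|` is
blind. -/
theorem PreEdgeBundle.deviationRate_of_isRegular {n : ℕ} (hn : 2 ≤ n) {B : PreEdgeBundle n}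
    (hB : B.IsRegular) : deviationRate B.shadow = nu n := by
  have hn0 : 0 < n := by omega
  set i₀ : Fin n := ⟨0, hn0⟩
  have hsin : ∀ (k : ℕ) (hk : k < n) (ω : ℝ), |Real.sin ((B.preEdge ⟨k, hk⟩).arg - ω)| =
      |Real.sin ((B.preEdge i₀).arg + k * (π / n) - ω)| := by
    intro k
    induction k with
    | zero => intro _ ω; simp [i₀]
    | succ k ih =>
      intro hk ω
      obtain ⟨z, hz⟩ := AddCommGroup.modEq_iff_zsmul.1 (hB.2 ⟨k, by omega⟩)
      rw [finRotate_val_of_lt hk] at hz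
      simp only [zsmul_eq_mul] at hz
      have e : (B.preEdge ⟨k + 1, hk⟩).arg - ω =
          (B.preEdge ⟨k, by omega⟩).arg - (ω - π / n) + (-z : ℤ) * π := by
        push_cast
        linarith
      rw [e, abs_sin_add_int_mul_pi, ih]
      congr 2
      push_cast
      ring
  have hr : 0 < ‖B.preEdge i₀‖ / 2 := half_pos (norm_pos_iff.2 (B.ne_zero i₀))
  rw [← deviationRate_equidistant hn hr (B.preEdge i₀).arg]
  congr 1
  funext ω
  rw [PreEdgeBundle.shadow, Finset.mul_sum, ← Fin.sum_univ_eq_sum_range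
    (fun j => ‖B.preEdge i₀‖ / 2 * |Real.sin ((B.preEdge i₀).arg + j * (π / n) - ω)|)]
  exact Finset.sum_congr rfl fun j _ => by rw [hB.1 j i₀, ← hsin j j.2]

theorem injective_of_range_eq {n : ℕ} {X : Type*} {a b : Fin n → X} (hb : Function.Injective b)
    (h : Set.range a = Set.range b) : Function.Injective a := by
  classical
  have h1 : Finset.univ.image a = Finset.univ.image b := by
    apply Finset.coe_injective
    simpa using h
  have h2 : (Finset.univ.image a).card = (Finset.univ : Finset (Fin n)).card := by
    rw [h1, Finset.card_image_of_injective _ hb]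
  have h3 := Finset.card_image_iff.1 h2
  rwa [Finset.coe_univ, Set.injOn_univ] at h3

theorem abbreviation_of_injective {n : ℕ} {a : Fin n → ℂ}
    (h : Function.Injective fun j => (a j).arg) : abbreviation a = Set.range a := by
  unfold abbreviation
  congr 1
  funext k
  have h1 : ∀ j, (a j).arg = (a k).arg ↔ j = k := fun j => ⟨fun e => h e, fun e => by rw [e]⟩
  simp only [h1, Finset.filter_eq', Finset.mem_univ, if_true, Finset.sum_singleton]

theorem PreEdgeBundle.injective {m : ℕ} (B : PreEdgeBundle m) : Function.Injective B.preEdge :=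
  fun _ _ h => B.strictMono_arg.injective (congrArg Complex.arg h)

/-- A bundle of the full size `n` leaves no room for merging: `n` distinct sums from `n` edges force
distinct arguments, so the pre-edges are just the vectors `iota (edge α j)`. -/
theorem IsAsymmetrization.shadow_eq {n : ℕ} {α : Fin n → ℂ} {B : PreEdgeBundle n}
    (h : IsAsymmetrization α B) : shadow α = B.shadow := by
  set β : Fin n → ℂ := fun j => iota (edge α j) with hβ
  have h1 : Function.Injective fun k => ∑ j with (β j).arg = (β k).arg, β j :=
    injective_of_range_eq B.injective h.symm
  have h2 : Function.Injective fun j => (β j).arg := by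
    intro j k hjk
    apply h1
    simp only at hjk ⊢
    rw [hjk]
  have h3 : Set.range B.preEdge = Set.range β := by
    rw [← abbreviation_of_injective h2]
    exact h
  have h4 : Function.Injective β := fun j k e => h2 (congrArg Complex.arg e)
  rw [shadow_eq_halfWidth, ← halfWidth_iota, B.shadow_eq_halfWidth]
  exact (halfWidth_eq_of_range_eq B.injective h4 h3).symm

theorem IsRegularFan.exists_isAsymmetrization {n : ℕ} {α : Fin n → ℂ} {r φ : ℝ}
    {σ : Equiv.Perm (Fin n)} (hr : 0 < r) (h : IsRegularFan (edge α) r φ σ) :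
    ∃ B : PreEdgeBundle n, B.IsRegular ∧ IsAsymmetrization α B := by
  have hne : ∀ k, edge α (σ k) ≠ 0 := fun k => by
    rw [← norm_pos_iff, (h k).1]
    exact hr
  have hmono : StrictMono fun k => (iota (edge α (σ k))).arg := by
    intro j k hjk
    have hn' : (0 : ℝ) < n := Nat.cast_pos.2 (by have := j.2; omega)
    simp only [(h _).2]
    have := mul_lt_mul_of_pos_right (show ((j : ℕ) : ℝ) < (k : ℕ) by exact_mod_cast hjk)
      (div_pos Real.pi_pos hn')
    linarith
  refine ⟨⟨fun k => iota (edge α (σ k)), fun k => iota_mem_upperHalf _,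
    fun k => iota_ne_zero (hne k), hmono⟩, ⟨fun j k => ?_, fun j => ?_⟩, ?_⟩
  · simp only [norm_iota, (h _).1]
  · have hn' : (n : ℝ) ≠ 0 := Nat.cast_ne_zero.2 (by have := j.2; omega)
    have hnd : n * (π / n) = π := by field_simp
    simp only [(h _).2]
    rw [AddCommGroup.modEq_iff_zsmul]
    rcases (Nat.succ_le_of_lt j.2).lt_or_eq with hj | hj
    · refine ⟨0, ?_⟩
      rw [finRotate_val_of_lt hj]
      push_cast
      simp only [zero_smul]
      ring
    -- From the last pre-edge back to the first the argument changes by `π / n - π`.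
    · refine ⟨1, ?_⟩
      have hj' : ((j : ℕ) : ℝ) + 1 = n := by exact_mod_cast hj
      rw [finRotate_val_of_eq hj, one_smul]
      push_cast
      rw [← hj'] at hnd ⊢
      linarith
  · have hinj : Function.Injective fun j => (iota (edge α j)).arg := by
      intro j k hjk
      have := hmono.injective (a₁ := σ.symm j) (a₂ := σ.symm k) (by simpa using hjk)
      exact σ.symm.injective this
    rw [IsAsymmetrization, abbreviation_of_injective hinj]
    exact σ.surjective.range_comp fun j => iota (edge α j)

/-! ### Polygons with prescribed edges -/

/-- The vectors `c_j exp(jπi/n)`. -/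
noncomputable def signedFan {n : ℕ} (c : Fin n → ℤ) (j : Fin n) : ℂ :=
  (c j : ℂ) * Complex.exp ((j : ℕ) * Real.pi * Complex.I / n)

theorem exp_fan (n k : ℕ) :
    Complex.exp (k * Real.pi * Complex.I / n) = Complex.exp ((k * (π / n) : ℝ) * Complex.I) := by
  congr 1
  push_cast
  ring

theorem signedFan_eq_or {n : ℕ} {c : Fin n → ℤ} (hc : ∀ j, c j = -1 ∨ c j = 1) (j : Fin n) :
    signedFan c j = Complex.exp (((j : ℕ) * (π / n) : ℝ) * Complex.I) ∨
      signedFan c j = -Complex.exp (((j : ℕ) * (π / n) : ℝ) * Complex.I) := by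
  rw [signedFan, exp_fan]
  rcases hc j with h | h <;> simp [h]

theorem norm_signedFan {n : ℕ} {c : Fin n → ℤ} (hc : ∀ j, c j = -1 ∨ c j = 1) (j : Fin n) :
    ‖signedFan c j‖ = 1 := by
  rcases signedFan_eq_or hc j with h | h
  · rw [h, Complex.norm_exp_ofReal_mul_I]
  · rw [h, norm_neg, Complex.norm_exp_ofReal_mul_I]

/-- Squaring forgets the signs and yields the `n` distinct `n`-th roots of unity. Hence no two
vectors of the fan are equal or opposite. -/
theorem signedFan_sq_injective {n : ℕ} {c : Fin n → ℤ} (hc : ∀ j, c j = -1 ∨ c j = 1) :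
    Function.Injective fun j => signedFan c j ^ 2 := by
  intro j k hjk
  have hn : n ≠ 0 := by have := j.2; omega
  have h : ∀ i : Fin n, signedFan c i ^ 2 = Complex.exp (2 * π * Complex.I / n) ^ (i : ℕ) := by
    intro i
    have : signedFan c i ^ 2 = Complex.exp (((i : ℕ) * (π / n) : ℝ) * Complex.I) ^ 2 := by
      rcases signedFan_eq_or hc i with h | h
      · rw [h]
      · rw [h, neg_sq]
    rw [this, ← Complex.exp_nat_mul, ← Complex.exp_nat_mul]
    congr 1
    push_cast
    ring
  simp only [h] at hjk
  exact Fin.ext ((Complex.isPrimitiveRoot_exp n hn).pow_inj j.2 k.2 hjk)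

theorem signedFan_injective {n : ℕ} {c : Fin n → ℤ} (hc : ∀ j, c j = -1 ∨ c j = 1) :
    Function.Injective (signedFan c) :=
  fun _ _ h => signedFan_sq_injective hc (congrArg (· ^ 2) h)

theorem deviationRate_of_range_edge_eq {n : ℕ} (hn : 2 ≤ n) {α : Fin n → ℂ} {c : Fin n → ℤ}
    (hc : ∀ j, c j = -1 ∨ c j = 1) (h : Set.range (edge α) = Set.range (signedFan c)) :
    deviationRate (shadow α) = nu n := by
  have hi := signedFan_injective hc
  rw [shadow_eq_halfWidth, halfWidth_eq_of_range_eq (injective_of_range_eq hi h) hi h,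
    halfWidth_congr (signedFan_eq_or hc), ← deviationRate_equidistant hn one_half_pos 0]
  congr 1
  funext ω
  rw [halfWidth, Finset.mul_sum,
    ← Fin.sum_univ_eq_sum_range (fun j => 1 / 2 * |Real.sin (0 + j * (π / n) - ω)|)]
  refine Finset.sum_congr rfl fun j _ => ?_
  rw [← Complex.exp_add, ← neg_mul, ← add_mul, ← Complex.ofReal_neg, ← Complex.ofReal_add,
    Complex.exp_ofReal_mul_I_im, zero_add, ← sub_eq_add_neg]
  ring

theorem edge_ne_zero {n : ℕ} (hn : 2 ≤ n) {α : Fin n → ℂ} (hα : Function.Injective α) (j : Fin n) :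
    edge α j ≠ 0 := by
  refine sub_ne_zero.2 fun h => ?_
  have h1 := congrArg Fin.val (hα h)
  rcases (Nat.succ_le_of_lt j.2).lt_or_eq with hj | hj
  · rw [finRotate_val_of_lt hj] at h1
    simp at h1
  · rw [finRotate_val_of_eq hj] at h1
    simp only at h1
    omega

/-- The lifts all move by `κ.arg`; the branch cut of `arg` is harmless since lifts are compared only
modulo `2 * π`. -/
theorem mul_mem_Theta {n : ℕ} (hn : 2 ≤ n) {α : Fin n → ℂ} (hα : α ∈ Theta n) {κ : ℂ}
    (hκ : κ ≠ 0) : (fun j => α j * κ) ∈ Theta n := by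
  obtain ⟨hinj, θ, h1, h2, h3⟩ := hα
  refine ⟨fun j k h => hinj (mul_right_cancel₀ hκ h), fun j => θ j + κ.arg, fun j => ?_,
    fun j k hjk => add_le_add_left (h2 hjk) _, fun j k => by linarith [h3 j k]⟩
  have e : edge (fun j => α j * κ) j = edge α j * κ := (sub_mul _ _ _).symm
  rw [e, Complex.arg_mul_coe_angle (edge_ne_zero hn hinj j) hκ, Real.Angle.coe_add, h1]

theorem IsRegularFan.exists_similar {n : ℕ} (hn : 2 ≤ n) {α : Fin n → ℂ} {r φ : ℝ}
    {σ : Equiv.Perm (Fin n)} (hr : 0 < r) (hα : α ∈ Theta n) (h : IsRegularFan (edge α) r φ σ) :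
    ∃ α' ∈ Theta n, Similar α α' ∧ ∃ c ∈ signVectors n,
      Set.range (edge α') = Set.range (signedFan c) := by
  have hr' : (r : ℂ) ≠ 0 := Complex.ofReal_ne_zero.2 hr.ne'
  -- This factor turns the initial direction `φ` to `0` and scales length `r` to `1`.
  set κ : ℂ := Complex.exp ((-φ : ℝ) * Complex.I) / r with hκ
  have hκ0 : κ ≠ 0 := div_ne_zero (Complex.exp_ne_zero _) hr'
  have hedge : ∀ j, edge (fun j => α j * κ) j = edge α j * κ := fun j => (sub_mul _ _ _).symm
  have hiota : ∀ k, iota (edge α (σ k)) * κ =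
      Complex.exp (((k : ℕ) * (π / n) : ℝ) * Complex.I) := by
    intro k
    rw [← Complex.norm_mul_exp_arg_mul_I (iota (edge α (σ k))), norm_iota, (h k).1, (h k).2, hκ,
      mul_assoc, ← mul_div_assoc, mul_div_cancel₀ _ hr', ← Complex.exp_add]
    congr 1
    push_cast
    ring
  have hc : ∀ k, ∃ c : ℤ, (c = -1 ∨ c = 1) ∧ edge (fun j => α j * κ) (σ k) =
      (c : ℂ) * Complex.exp ((k : ℕ) * Real.pi * Complex.I / n) := by
    intro k
    rw [exp_fan, ← hiota, hedge]
    rcases iota_eq_or (edge α (σ k)) with h | h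
    · exact ⟨1, Or.inr rfl, by simp [h]⟩
    · exact ⟨-1, Or.inl rfl, by simp [h]⟩
  choose c hc1 hc2 using hc
  refine ⟨_, mul_mem_Theta hn hα hκ0, ?_, c, ⟨hc1, ?_⟩, ?_⟩
  · rw [similar_iff_exists_pos_dist_eq]
    refine ⟨‖κ‖⁻¹, inv_pos.2 (norm_pos_iff.2 hκ0), fun i j => ?_⟩
    rw [dist_eq_norm, dist_eq_norm, ← sub_mul, norm_mul, mul_comm ‖κ‖⁻¹,
      mul_inv_cancel_right₀ (norm_ne_zero_iff.2 hκ0)]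
  · rw [← sum_edge (fun j => α j * κ), ← Equiv.sum_comp σ (edge fun j => α j * κ)]
    exact Finset.sum_congr rfl fun k _ => (hc2 k).symm
  · rw [← σ.surjective.range_comp (edge fun j => α j * κ)]
    congr 1
    funext k
    exact hc2 k

/-- The polygon with given edges, starting at `0`. -/
noncomputable def polygonOfEdges {n : ℕ} (e : Fin n → ℂ) (k : Fin n) : ℂ :=
  ∑ j, if j < k then e j else 0

theorem edge_polygonOfEdges {n : ℕ} {e : Fin n → ℂ} (h : ∑ j, e j = 0) :
    edge (polygonOfEdges e) = e := by
  funext k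
  rw [edge, polygonOfEdges, polygonOfEdges]
  rcases (Nat.succ_le_of_lt k.2).lt_or_eq with hk | hk
  · rw [finRotate_val_of_lt hk, ← Finset.sum_sub_distrib]
    have : ∀ j : Fin n, (if j < ⟨k + 1, hk⟩ then e j else 0) - (if j < k then e j else 0) =
        if j = k then e j else 0 := by
      intro j
      simp only [Fin.lt_def, Fin.ext_iff]
      split_ifs <;> first | omega | simp
    simp [this]
  · rw [finRotate_val_of_eq hk]
    have h1 : ∀ j : Fin n, ¬ j < ⟨0, by omega⟩ := fun j => by simp [Fin.lt_def]
    simp only [h1, if_false, Finset.sum_const_zero]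
    refine (congrArg (· - _) h.symm).trans ?_
    simp only [← Finset.sum_sub_distrib]
    have : ∀ j : Fin n, e j - (if j < k then e j else 0) = if j = k then e j else 0 := by
      intro j
      have := j.2
      simp only [Fin.lt_def, Fin.ext_iff]
      split_ifs <;> first | omega | simp
    simp [this]

/-- If the vertices coincided, the edges from `a` to `b - 1` would sum to zero. Project onto the
bisector `μ` of their range of arguments. If the range is narrower than `π`, the projections in the
block are nonnegative and not all zero. If it is wider, all edges outside the block, `b` among them,
project negatively, yet they also sum to zero. Width exactly `π` is excluded by `hne`. -/
theorem polygonOfEdges_ne {n : ℕ} {e : Fin n → ℂ} (h : ∑ j, e j = 0) (hnorm : ∀ j, ‖e j‖ = 1)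
    (hmono : StrictMono fun j => (e j).arg) (hne : ∀ j k, (e k).arg - (e j).arg ≠ π)
    {a b : Fin n} (hab : a < b) : polygonOfEdges e a ≠ polygonOfEdges e b := by
  intro heq
  have hab' : (a : ℕ) < b := hab
  set m : Fin n := ⟨b - 1, by omega⟩ with hm
  have ham : (e a).arg ≤ (e m).arg := hmono.monotone (Fin.le_def.2 (by simp only [hm]; omega))
  set μ := ((e a).arg + (e m).arg) / 2 with hμ
  have hre : ∀ j, (e j * Complex.exp ((-μ : ℝ) * Complex.I)).re = Real.cos ((e j).arg - μ) := by
    intro j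
    conv_lhs => rw [← Complex.norm_mul_exp_arg_mul_I (e j)]
    rw [hnorm, Complex.ofReal_one, one_mul, ← Complex.exp_add, ← add_mul, ← Complex.ofReal_add,
      Complex.exp_ofReal_mul_I_re, sub_eq_add_neg]
  have hblock : ∑ j, (if a ≤ j ∧ j < b then Real.cos ((e j).arg - μ) else 0) = 0 := by
    have h1 : ∑ j, (if a ≤ j ∧ j < b then e j else 0) = 0 := by
      refine Eq.trans ?_ (sub_eq_zero.2 heq.symm)
      rw [polygonOfEdges, polygonOfEdges, ← Finset.sum_sub_distrib]
      refine Finset.sum_congr rfl fun j _ => ?_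
      simp only [Fin.lt_def, Fin.le_def]
      split_ifs <;> first | omega | simp
    have h2 := congrArg (fun z : ℂ => (z * Complex.exp ((-μ : ℝ) * Complex.I)).re) h1
    simp only [Finset.sum_mul, Complex.re_sum, zero_mul, Complex.zero_re] at h2
    refine Eq.trans ?_ h2
    refine Finset.sum_congr rfl fun j _ => ?_
    rw [← hre]
    split_ifs <;> simp
  have hall : ∑ j, Real.cos ((e j).arg - μ) = 0 := by
    simp only [← hre]
    rw [← Complex.re_sum, ← Finset.sum_mul, h, zero_mul, Complex.zero_re]
  have hm1 : ∀ j, j < b → (e j).arg ≤ (e m).arg := fun j hj =>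
    hmono.monotone (Fin.le_def.2 (by simp only [hm]; have := Fin.lt_def.1 hj; omega))
  rcases (hne a m).lt_or_gt with hlt | hgt
  · refine hblock.not_gt (Finset.sum_pos' (fun j _ => ?_) ⟨a, Finset.mem_univ a, ?_⟩)
    · split_ifs with hj
      · have h1 : (e a).arg ≤ (e j).arg := hmono.monotone hj.1
        have h2 := hm1 j hj.2
        exact Real.cos_nonneg_of_mem_Icc ⟨by linarith, by linarith⟩
      · exact le_rfl
    · rw [if_pos ⟨le_rfl, hab⟩]
      exact Real.cos_pos_of_mem_Ioo ⟨by linarith, by linarith⟩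
  · have hneg : ∀ j, ¬ (a ≤ j ∧ j < b) → Real.cos ((e j).arg - μ) < 0 := by
      intro j hj
      have h1 := Complex.arg_le_pi (e j)
      have h2 := Complex.neg_pi_lt_arg (e j)
      have h3 := Complex.arg_le_pi (e m)
      have h4 := Complex.neg_pi_lt_arg (e a)
      rcases lt_or_ge j a with hja | hja
      · have h5 : (e j).arg < (e a).arg := hmono hja
        rw [← Real.cos_neg]
        exact Real.cos_neg_of_pi_div_two_lt_of_lt (by linarith) (by linarith)
      · have h5 : (e m).arg < (e j).arg := hmono (Fin.lt_def.2 (by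
          simp only [hm]
          have := Fin.le_def.1 (not_lt.1 fun h => hj ⟨hja, h⟩)
          omega))
        exact Real.cos_neg_of_pi_div_two_lt_of_lt (by linarith) (by linarith)
    have hcompl : ∑ j, (if a ≤ j ∧ j < b then 0 else -Real.cos ((e j).arg - μ)) = 0 := by
      have h1 := congrArg₂ (· - ·) hblock hall
      simp only [← Finset.sum_sub_distrib, sub_zero] at h1
      refine Eq.trans ?_ h1
      refine Finset.sum_congr rfl fun j _ => ?_
      split_ifs <;> simp
    refine hcompl.not_gt (Finset.sum_pos' (fun j _ => ?_) ⟨b, Finset.mem_univ b, ?_⟩)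
    · split_ifs with hj
      · exact le_rfl
      · exact (neg_pos.2 (hneg j hj)).le
    · rw [if_neg fun h => lt_irrefl _ h.2]
      exact neg_pos.2 (hneg b fun h => lt_irrefl _ h.2)

/-- Laying the fan end to end in order of argument closes up and turns at most once. Distinct
squares exclude parallel edges, which gives the strictness needed for distinct vertices. -/
theorem exists_polygon_of_signVector {n : ℕ} {c : Fin n → ℤ} (hc : c ∈ signVectors n) :
    ∃ α ∈ Theta n, Set.range (edge α) = Set.range (signedFan c) := by
  set τ := Tuple.sort fun j => (signedFan c j).arg with hτ
  set e : Fin n → ℂ := signedFan c ∘ τ with he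
  have hnorm : ∀ j, ‖e j‖ = 1 := fun j => norm_signedFan hc.1 (τ j)
  have hexp : ∀ j, e j = Complex.exp ((e j).arg * Complex.I) := by
    intro j
    conv_lhs => rw [← Complex.norm_mul_exp_arg_mul_I (e j), hnorm]
    simp
  have hsum : ∑ j, e j = 0 := by
    rw [← hc.2]
    exact Equiv.sum_comp τ (signedFan c)
  have hinj : ∀ j k, e j ^ 2 = e k ^ 2 → j = k := fun j k hjk =>
    τ.injective (signedFan_sq_injective hc.1 hjk)
  have hm : Monotone fun j => (e j).arg := Tuple.monotone_sort fun j => (signedFan c j).arg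
  have hmono : StrictMono fun j => (e j).arg := by
    refine hm.strictMono_of_injective fun j k hjk => hinj j k ?_
    simp only at hjk
    rw [hexp j, hexp k, hjk]
  have hne : ∀ j k, (e k).arg - (e j).arg ≠ π := by
    intro j k hjk
    have h1 : e k = -e j := by
      rw [hexp k, hexp j, eq_add_of_sub_eq hjk, Complex.ofReal_add, add_mul, Complex.exp_add,
        Complex.exp_pi_mul_I, neg_one_mul]
    rw [hinj k j (by rw [h1, neg_sq]), sub_self] at hjk
    exact Real.pi_ne_zero hjk.symm
  have hedge := edge_polygonOfEdges hsum
  refine ⟨polygonOfEdges e, ⟨?_, fun j => (e j).arg, fun j => by rw [hedge], hm, fun j k => ?_⟩, ?_⟩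
  · intro a b hab
    by_contra h
    rcases lt_or_gt_of_ne h with h | h
    · exact polygonOfEdges_ne hsum hnorm hmono hne h hab
    · exact polygonOfEdges_ne hsum hnorm hmono hne h hab.symm
  · linarith [Complex.arg_le_pi (e k), Complex.neg_pi_lt_arg (e j)]
  · rw [hedge]
    exact τ.surjective.range_comp _

/-- Write `n = m * p` with `m` a power of 2 and `p > 1` odd, and alternate the signs in blocks of
length `m`. The sum factors through a geometric sum with ratio `-ζ ^ m`. This ratio has `p`-th power
`-ζ ^ n = 1`, but is not `1` because `ζ ^ m = exp (π i / p)` is not real, so the geometric sum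
vanishes. -/
theorem signVectors_nonempty {n : ℕ} (hn : n ≠ 0) (hpow : ¬ ∃ k : ℕ, n = 2 ^ k) :
    (signVectors n).Nonempty := by
  obtain ⟨s, p, hp, hnp⟩ := Nat.exists_eq_two_pow_mul_odd hn
  set m := 2 ^ s with hm
  have hm0 : 0 < m := by positivity
  have hp3 : 1 < p := by
    rcases hp with ⟨t, rfl⟩
    rcases Nat.eq_zero_or_pos t with rfl | h
    · exact absurd ⟨s, by simpa using hnp⟩ hpow
    · omega
  have hn' : (n : ℂ) ≠ 0 := Nat.cast_ne_zero.2 hn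
  set ζ : ℂ := Complex.exp (π * Complex.I / n) with hζ
  have hζn : ζ ^ n = -1 := by
    rw [hζ, ← Complex.exp_nat_mul, mul_div_cancel₀ _ hn', Complex.exp_pi_mul_I]
  have hζm : -ζ ^ m - 1 ≠ 0 := by
    intro h
    have hp0 : (0 : ℝ) < p := by exact_mod_cast (by omega : 0 < p)
    have h1 : ζ ^ m = Complex.exp ((π / p : ℝ) * Complex.I) := by
      rw [hζ, ← Complex.exp_nat_mul, hnp]
      congr 1
      have h2 : (m : ℂ) ≠ 0 := Nat.cast_ne_zero.2 hm0.ne'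
      have h3 : (p : ℂ) ≠ 0 := Nat.cast_ne_zero.2 (by omega)
      push_cast
      field_simp
    have h2 := congrArg Complex.im h
    rw [h1, Complex.sub_im, Complex.neg_im, Complex.exp_ofReal_mul_I_im, Complex.one_im,
      Complex.zero_im] at h2
    have h3 := Real.sin_pos_of_pos_of_lt_pi (div_pos Real.pi_pos hp0)
      (div_lt_self Real.pi_pos (by exact_mod_cast hp3))
    linarith
  have hblock : ∀ b : ℕ, ∑ j ∈ Finset.range (m * b), (-1 : ℂ) ^ (j / m) * ζ ^ j =
      (∑ a ∈ Finset.range m, ζ ^ a) * ∑ i ∈ Finset.range b, (-ζ ^ m) ^ i := by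
    intro b
    induction b with
    | zero => simp
    | succ b ih =>
      rw [Nat.mul_succ, Finset.sum_range_add, ih, Finset.sum_range_succ, mul_add]
      congr 1
      rw [Finset.sum_mul]
      refine Finset.sum_congr rfl fun a ha => ?_
      rw [Nat.mul_add_div hm0, Nat.div_eq_of_lt (Finset.mem_range.1 ha), add_zero, pow_add, pow_mul,
        neg_pow (ζ ^ m)]
      ring
  refine ⟨fun j => (-1) ^ ((j : ℕ) / m), fun j => (neg_one_pow_eq_or ℤ _).symm, ?_⟩
  have h1 : ∀ j : Fin n, (((-1) ^ ((j : ℕ) / m) : ℤ) : ℂ) *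
      Complex.exp ((j : ℕ) * π * Complex.I / n) = (-1) ^ ((j : ℕ) / m) * ζ ^ (j : ℕ) := by
    intro j
    rw [hζ, ← Complex.exp_nat_mul]
    push_cast
    congr 2
    ring
  simp only [h1]
  have hgeom : ∑ i ∈ Finset.range p, (-ζ ^ m) ^ i = 0 := by
    have h2 := geom_sum_mul (-ζ ^ m) p
    rw [hp.neg_pow, ← pow_mul, ← hnp, hζn, neg_neg, sub_self] at h2
    exact (mul_eq_zero.1 h2).resolve_right hζm
  rw [Fin.sum_univ_eq_sum_range (fun j => (-1 : ℂ) ^ (j / m) * ζ ^ j) n]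
  conv_lhs => rw [hnp]
  rw [hblock, hgeom, mul_zero]

end PolygonWidth

/-! ### The minimum and its equality cases -/

theorem mainTheorem1 (n : ℕ) (hn : 2 ≤ n) (hpow : ¬ ∃ k : ℕ, n = 2 ^ k) :
    IsLeast ((fun α => PolygonWidth.deviationRate (PolygonWidth.shadow α)) ''
        PolygonWidth.Theta n) (PolygonWidth.nu n) ∧
      (∀ B : PolygonWidth.PreEdgeBundle n, B.IsRegular →
        PolygonWidth.deviationRate B.shadow = PolygonWidth.nu n) ∧
      ∀ α ∈ PolygonWidth.Theta n,
        (PolygonWidth.deviationRate (PolygonWidth.shadow α) = PolygonWidth.nu n ↔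
          ∃ B : PolygonWidth.PreEdgeBundle n, B.IsRegular ∧
            PolygonWidth.IsAsymmetrization α B) ∧
        (PolygonWidth.deviationRate (PolygonWidth.shadow α) = PolygonWidth.nu n ↔
          ∃ α' ∈ PolygonWidth.Theta n, Similar α α' ∧
            ∃ c ∈ PolygonWidth.signVectors n,
              Set.range (PolygonWidth.edge α') =
                Set.range fun j : Fin n =>
                  (c j : ℂ) * Complex.exp ((j : ℕ) * Real.pi * Complex.I / n)) := by
  have hbound := fun (α : Fin n → ℂ) (hα : α ∈ PolygonWidth.Theta n) =>
    PolygonWidth.nu_le_deviationRate_halfWidth hn (PolygonWidth.edge_ne_zero hn hα.1)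
  simp only [← PolygonWidth.shadow_eq_halfWidth] at hbound
  refine ⟨⟨?_, ?_⟩, fun B hB => PolygonWidth.PreEdgeBundle.deviationRate_of_isRegular hn hB,
    fun α hα => ⟨⟨fun h => ?_, ?_⟩, fun h => ?_, ?_⟩⟩
  · obtain ⟨c, hc⟩ := PolygonWidth.signVectors_nonempty (by omega) hpow
    obtain ⟨α, hα, h⟩ := PolygonWidth.exists_polygon_of_signVector hc
    exact ⟨α, hα, PolygonWidth.deviationRate_of_range_edge_eq hn hc.1 h⟩
  · rintro _ ⟨α, hα, rfl⟩
    exact (hbound α hα).1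
  · obtain ⟨r, φ, hr, σ, hσ⟩ := (hbound α hα).2 h
    exact hσ.exists_isAsymmetrization hr
  · rintro ⟨B, hB, hαB⟩
    rw [hαB.shadow_eq]
    exact PolygonWidth.PreEdgeBundle.deviationRate_of_isRegular hn hB
  · obtain ⟨r, φ, hr, σ, hσ⟩ := (hbound α hα).2 h
    exact hσ.exists_similar hn hr hα
  · rintro ⟨α', -, hs, c, hc, h⟩
    rw [PolygonWidth.deviationRate_shadow_of_similar hs]
    exact PolygonWidth.deviationRate_of_range_edge_eq hn hc.1 h
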